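/- Let $0<\varepsilon<2$ and, for $x\in(0,1)$, put $$p(x)=(1-x)^{1+1/\varepsilon}(x+1)^{1-1/\varepsilon},\qquad w(x)=x^{-1}(1-x)^{1/\varepsilon}(x+1)^{-1/\varepsilon}.$$ Let $L$ be the unbounded operator in the complex Hilbert space $L^2((0,1),w(x)\,dx)$ given by $$Lf=-w^{-1}(pf')'$$ on the domain $\{f\in\mathcal C^\infty([0,1]) : f(0)=0\}$. Then there exists a complete orthonormal set $\{f_n\}_{n=1}^\infty$ of eigenvectors of $L$ (lying in this domain), $Lf_n=\mu_nf_n$, whose eigenvalues satisfy $\mu_n\ge 0$, $\mu_n\le\mu_{n+1}$ for all $n$, and $\mu_n\to+\infty$ as $n\to\infty$. Every eigenvalue of $L$ is one of the $\mu_n$. -/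

import Mathlib

open MeasureTheory Set Filter Topology
open scoped ContDiff

namespace SturmLiouville

noncomputable section

/-- The coefficient `p(x) = (1-x)^{1+1/ε} (x+1)^{1-1/ε}`. -/
def p (ε x : ℝ) : ℝ := (1 - x) ^ (1 + 1 / ε) * (x + 1) ^ (1 - 1 / ε)

/-- The weight `w(x) = x^{-1} (1-x)^{1/ε} (x+1)^{-1/ε}`. -/
def w (ε x : ℝ) : ℝ := x⁻¹ * (1 - x) ^ (1 / ε) * (x + 1) ^ (-(1 / ε))

/-- The measure `w(x) dx` on the interval `(0,1)`. -/
def wMeasure (ε : ℝ) : Measure ℝ :=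
  (volume.restrict (Ioo (0 : ℝ) 1)).withDensity fun x => ENNReal.ofReal (w ε x)

/-- The complex Hilbert space `L²((0,1), w(x) dx)`. -/
abbrev H (ε : ℝ) : Type := Lp ℂ 2 (wMeasure ε)

/-- `C₀^∞([0,1])`: the functions that are smooth on the closed interval `[0,1]` (one-sided
derivatives at the endpoints) and vanish at `0`. Values outside `[0,1]` are irrelevant. -/
def smoothZero : Submodule ℂ (ℝ → ℂ) where
  carrier := {f | ContDiffOn ℝ ∞ f (Icc 0 1) ∧ f 0 = 0}
  add_mem' := by
    rintro f g ⟨hf, hf0⟩ ⟨hg, hg0⟩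
    exact ⟨hf.add hg, by simp [hf0, hg0]⟩
  zero_mem' := ⟨contDiffOn_const, rfl⟩
  smul_mem' := by
    rintro c f ⟨hf, hf0⟩
    exact ⟨contDiffOn_const.smul hf, by simp [hf0]⟩

/-- The differential expression `-w⁻¹ (p f')'`. -/
def expr (ε : ℝ) (f : ℝ → ℂ) (x : ℝ) : ℂ :=
  -((w ε x : ℂ)⁻¹ * deriv (fun y => (p ε y : ℂ) * deriv f y) x)

lemma memLp_of_bound (ε : ℝ) (hε : 0 < ε) (g : ℝ → ℂ) (hg : ContinuousOn g (Ioo 0 1)) (C : ℝ)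
    (hC : ∀ x ∈ Ioo (0 : ℝ) 1, ‖g x‖ ≤ C * x) : MemLp g 2 (wMeasure ε) := by
  have hw : Measurable fun x => ENNReal.ofReal (w ε x) := by unfold w; fun_prop
  refine ⟨(hg.aestronglyMeasurable measurableSet_Ioo).mono_ac
    (withDensity_absolutelyContinuous _ _), ?_⟩
  rw [eLpNorm_lt_top_iff_lintegral_rpow_enorm_lt_top (by norm_num) (by norm_num)]
  unfold wMeasure
  rw [lintegral_withDensity_eq_lintegral_mul₀' hw.aemeasurable
    (((hg.aestronglyMeasurable measurableSet_Ioo).mono_ac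
      (withDensity_absolutelyContinuous _ _)).enorm.pow_const _)]
  have hb : ∀ x ∈ Ioo (0 : ℝ) 1,
      ((fun x => ENNReal.ofReal (w ε x)) * fun x => ‖g x‖ₑ ^ (2 : ENNReal).toReal) x
        ≤ ENNReal.ofReal (C ^ 2) := by
    intro x hx
    have h1 : (1 - x) ^ (1 / ε) ≤ 1 :=
      Real.rpow_le_one (by linarith [hx.2]) (by linarith [hx.1]) (by positivity)
    have h2 : (x + 1) ^ (-(1 / ε)) ≤ 1 :=
      Real.rpow_le_one_of_one_le_of_nonpos (by linarith [hx.1])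
        (by have : 0 < 1 / ε := by positivity
            linarith)
    have h10 : 0 ≤ (1 - x) ^ (1 / ε) := Real.rpow_nonneg (by linarith [hx.2]) _
    have h20 : 0 ≤ (x + 1) ^ (-(1 / ε)) := Real.rpow_nonneg (by linarith [hx.1]) _
    have hx0 := hx.1
    have hw1 : w ε x ≤ x⁻¹ := by
      unfold w
      have : (1 - x) ^ (1 / ε) * (x + 1) ^ (-(1 / ε)) ≤ 1 := mul_le_one₀ h1 h20 h2
      rw [mul_assoc]
      exact mul_le_of_le_one_right (by positivity) this
    have hw0 : 0 ≤ w ε x := by unfold w; positivity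
    have hn := hC x hx
    simp only [Pi.mul_apply, ENNReal.toReal_ofNat]
    rw [← ofReal_norm, ENNReal.ofReal_rpow_of_nonneg (norm_nonneg _) (by norm_num),
      ← ENNReal.ofReal_mul hw0]
    apply ENNReal.ofReal_le_ofReal
    rw [Real.rpow_ofNat]
    calc w ε x * ‖g x‖ ^ 2 ≤ x⁻¹ * (C * x) ^ 2 := by gcongr
      _ = C ^ 2 * x := by field_simp
      _ ≤ C ^ 2 := mul_le_of_le_one_right (by positivity) hx.2.le
  calc _ ≤ ∫⁻ x in Ioo (0 : ℝ) 1, ENNReal.ofReal (C ^ 2) :=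
        setLIntegral_mono measurable_const hb
    _ < ⊤ := by simp

lemma contDiffOn_deriv {f : ℝ → ℂ} (hf : f ∈ smoothZero) :
    ContDiffOn ℝ ∞ (derivWithin f (Icc 0 1)) (Icc 0 1) :=
  hf.1.derivWithin (uniqueDiffOn_Icc zero_lt_one) (by simp)

lemma differentiableAt_of_mem {f : ℝ → ℂ} (hf : ContDiffOn ℝ ∞ f (Icc 0 1)) {x : ℝ}
    (hx : x ∈ Ioo (0 : ℝ) 1) : DifferentiableAt ℝ f x :=
  (hf.contDiffAt (Icc_mem_nhds hx.1 hx.2)).differentiableAt (by simp)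

lemma deriv_eqOn {f : ℝ → ℂ} : EqOn (deriv f) (derivWithin f (Icc 0 1)) (Ioo 0 1) :=
  fun _ hx => (derivWithin_of_mem_nhds (Icc_mem_nhds hx.1 hx.2)).symm

lemma w_pos (ε : ℝ) {x : ℝ} (hx : x ∈ Ioo (0 : ℝ) 1) : 0 < w ε x := by
  have h1 : 0 < 1 - x := by linarith [hx.2]
  have h2 : 0 < x + 1 := by linarith [hx.1]
  have hx0 := hx.1
  unfold w
  positivity

lemma p_eq (ε : ℝ) {x : ℝ} (hx : x ∈ Ioo (0 : ℝ) 1) : p ε x = w ε x * (x * (1 - x ^ 2)) := by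
  have h1 : 0 < 1 - x := by linarith [hx.2]
  have h2 : 0 < x + 1 := by linarith [hx.1]
  have hx0 := hx.1.ne'
  unfold p w
  rw [Real.rpow_add h1, sub_eq_add_neg 1 (1 / ε), Real.rpow_add h2, Real.rpow_one, Real.rpow_one]
  field_simp
  ring

lemma hasDerivAt_p (ε : ℝ) {x : ℝ} (hx : x ∈ Ioo (0 : ℝ) 1) :
    HasDerivAt (p ε) (-(w ε x * (x * (2 / ε + 2 * x)))) x := by
  have h1 : 0 < 1 - x := by linarith [hx.2]
  have h2 : 0 < x + 1 := by linarith [hx.1]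
  have hx0 := hx.1.ne'
  have a : HasDerivAt (fun x : ℝ => (1 - x) ^ (1 + 1 / ε)) _ x :=
    ((hasDerivAt_id x).const_sub 1).rpow_const (Or.inl h1.ne')
  have b : HasDerivAt (fun x : ℝ => (x + 1) ^ (1 - 1 / ε)) _ x :=
    ((hasDerivAt_id x).add_const 1).rpow_const (Or.inl h2.ne')
  refine (a.mul b).congr_deriv ?_
  simp only [id]
  rw [show 1 + 1 / ε - 1 = 1 / ε by ring, show 1 - 1 / ε - 1 = -(1 / ε) by ring,
    Real.rpow_add h1, sub_eq_add_neg 1 (1 / ε), Real.rpow_add h2, Real.rpow_one, Real.rpow_one]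
  unfold w
  field_simp
  ring

/-- On `(0,1)` the expression `-w⁻¹ (p f')'` is
`x (2/ε + 2x) f'(x) - x (1 - x²) f''(x)`. -/
lemma expr_eq (ε : ℝ) {f : ℝ → ℂ} (hf : f ∈ smoothZero) {x : ℝ} (hx : x ∈ Ioo (0 : ℝ) 1) :
    expr ε f x = (x : ℂ) * (((2 / ε + 2 * x : ℝ) : ℂ) * derivWithin f (Icc 0 1) x
      - ((1 - x ^ 2 : ℝ) : ℂ) *
        derivWithin (derivWithin f (Icc 0 1)) (Icc 0 1) x) := by
  have hd := (contDiffOn_deriv hf)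
  have h2 : HasDerivAt (deriv f) (derivWithin (derivWithin f (Icc 0 1)) (Icc 0 1) x) x := by
    have := (differentiableAt_of_mem hd hx).hasDerivAt
    rw [deriv_eqOn hx] at this
    exact this.congr_of_eventuallyEq
      (deriv_eqOn.eventuallyEq_of_mem (Ioo_mem_nhds hx.1 hx.2))
  have h := ((hasDerivAt_p ε hx).ofReal_comp.mul h2).deriv
  have hw : (w ε x : ℂ) ≠ 0 := by exact_mod_cast (w_pos ε hx).ne'
  unfold expr
  erw [h]
  rw [deriv_eqOn hx, p_eq ε hx]
  push_cast
  field_simp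
  ring

lemma smooth_memLp {ε : ℝ} (hε : 0 < ε) {f : ℝ → ℂ} (hf : f ∈ smoothZero) :
    MemLp f 2 (wMeasure ε) := by
  obtain ⟨M, hM⟩ := isCompact_Icc.exists_bound_of_continuousOn (contDiffOn_deriv hf).continuousOn
  refine memLp_of_bound ε hε f (hf.1.continuousOn.mono Ioo_subset_Icc_self) M fun x hx => ?_
  have := (convex_Icc (0 : ℝ) 1).norm_image_sub_le_of_norm_derivWithin_le
    (hf.1.differentiableOn (by simp)) hM (left_mem_Icc.2 zero_le_one) (Ioo_subset_Icc_self hx)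
  simpa [hf.2, abs_of_pos hx.1] using this

lemma expr_memLp {ε : ℝ} (hε : 0 < ε) {f : ℝ → ℂ} (hf : f ∈ smoothZero) :
    MemLp (expr ε f) 2 (wMeasure ε) := by
  have hd := contDiffOn_deriv hf
  have hdd : ContDiffOn ℝ ∞ (derivWithin (derivWithin f (Icc 0 1)) (Icc 0 1)) (Icc 0 1) :=
    hd.derivWithin (uniqueDiffOn_Icc zero_lt_one) (by simp)
  have hc : ContinuousOn (fun x : ℝ => ((2 / ε + 2 * x : ℝ) : ℂ) * derivWithin f (Icc 0 1) x
      - ((1 - x ^ 2 : ℝ) : ℂ) *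
        derivWithin (derivWithin f (Icc 0 1)) (Icc 0 1) x) (Icc 0 1) := by
    refine ContinuousOn.sub (ContinuousOn.mul ?_ hd.continuousOn)
      (ContinuousOn.mul ?_ hdd.continuousOn)
    · exact (Continuous.continuousOn (by fun_prop))
    · exact (Continuous.continuousOn (by fun_prop))
  obtain ⟨M, hM⟩ := isCompact_Icc.exists_bound_of_continuousOn hc
  refine memLp_of_bound ε hε _ ?_ M fun x hx => ?_
  · refine ContinuousOn.congr (((Complex.continuous_ofReal.continuousOn).mul
      (hc.mono Ioo_subset_Icc_self))) fun x hx => expr_eq ε hf hx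
  · rw [expr_eq ε hf hx, norm_mul, Complex.norm_real, Real.norm_eq_abs, abs_of_pos hx.1, mul_comm]
    exact mul_le_mul_of_nonneg_right (hM x (Ioo_subset_Icc_self hx)) hx.1.le

lemma ae_wMeasure {ε : ℝ} {P : ℝ → Prop} (h : ∀ x ∈ Ioo (0 : ℝ) 1, P x) :
    ∀ᵐ x ∂(wMeasure ε), P x :=
  (withDensity_absolutelyContinuous _ _).ae_le
    ((ae_restrict_iff' measurableSet_Ioo).2 (Eventually.of_forall h))

/-- The map sending `f ∈ C₀^∞([0,1])` to its class in `L²((0,1), w dx)`. -/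
def incl {ε : ℝ} (hε : 0 < ε) : smoothZero →ₗ[ℂ] H ε where
  toFun f := (smooth_memLp hε f.2).toLp
  map_add' _ _ := MemLp.toLp_add _ _
  map_smul' c f := MemLp.toLp_const_smul c (smooth_memLp hε f.2)

/-- The map sending `f ∈ C₀^∞([0,1])` to the class of `-w⁻¹ (p f')'` in `L²((0,1), w dx)`. -/
def exprMap {ε : ℝ} (hε : 0 < ε) : smoothZero →ₗ[ℂ] H ε where
  toFun f := (expr_memLp hε f.2).toLp
  map_add' f g := by
    rw [← MemLp.toLp_add, MemLp.toLp_eq_toLp_iff]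
    refine ae_wMeasure fun x hx => ?_
    have e1 : EqOn (derivWithin ((f : ℝ → ℂ) + (g : ℝ → ℂ)) (Icc (0 : ℝ) 1))
        (derivWithin (f : ℝ → ℂ) (Icc 0 1) + derivWithin (g : ℝ → ℂ) (Icc 0 1)) (Icc 0 1) := fun y hy =>
      derivWithin_add (f.2.1.differentiableOn (by simp) y hy)
        (g.2.1.differentiableOn (by simp) y hy)
    rw [Pi.add_apply, expr_eq ε f.2 hx, expr_eq ε g.2 hx, expr_eq ε (f + g).2 hx]
    have hx' := Ioo_subset_Icc_self hx
    rw [Submodule.coe_add, derivWithin_congr e1 (e1 hx'), e1 hx',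
      derivWithin_add ((contDiffOn_deriv f.2).differentiableOn (by simp) x hx')
        ((contDiffOn_deriv g.2).differentiableOn (by simp) x hx'), Pi.add_apply]
    ring
  map_smul' c f := by
    rw [RingHom.id_apply, ← MemLp.toLp_const_smul, MemLp.toLp_eq_toLp_iff]
    refine ae_wMeasure fun x hx => ?_
    have e1 : EqOn (derivWithin (c • (f : ℝ → ℂ)) (Icc 0 1))
        (c • derivWithin f (Icc 0 1)) (Icc 0 1) := fun y hy =>
      derivWithin_const_smul c (f.2.1.differentiableOn (by simp) y hy)
    rw [Pi.smul_apply, expr_eq ε f.2 hx, expr_eq ε (c • f).2 hx]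
    have hx' := Ioo_subset_Icc_self hx
    rw [Submodule.coe_smul, derivWithin_congr e1 (e1 hx'), e1 hx',
      derivWithin_const_smul c ((contDiffOn_deriv f.2).differentiableOn (by simp) x hx'),
      Pi.smul_apply]
    simp only [smul_eq_mul]
    ring

lemma ae_eq_zero_imp {ε : ℝ} {f : ℝ → ℂ} (hf : ContinuousOn f (Ioo 0 1))
    (h : f =ᵐ[wMeasure ε] 0) : EqOn f 0 (Ioo 0 1) := by
  have hw : Measurable fun x => ENNReal.ofReal (w ε x) := by unfold w; fun_prop
  have h1 : f =ᵐ[volume.restrict (Ioo 0 1)] 0 := by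
    have h2 := (ae_withDensity_iff hw).1 h
    have h3 := ae_restrict_mem (μ := volume) (measurableSet_Ioo (a := (0 : ℝ)) (b := 1))
    filter_upwards [h2, h3] with x hx hx1
    exact hx (by simpa using w_pos ε hx1)
  exact Measure.eqOn_open_of_ae_eq h1 isOpen_Ioo hf continuousOn_const

lemma expr_eq_zero (ε : ℝ) {f : ℝ → ℂ} (h : EqOn f 0 (Ioo 0 1)) :
    EqOn (expr ε f) 0 (Ioo 0 1) := by
  intro x hx
  have d1 : EqOn (deriv f) 0 (Ioo 0 1) := fun y hy => by
    rw [(h.eventuallyEq_of_mem (Ioo_mem_nhds hy.1 hy.2)).deriv_eq]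
    exact deriv_const y (0 : ℂ)
  have d2 : EqOn (fun y => (p ε y : ℂ) * deriv f y) (fun _ => 0) (Ioo 0 1) := fun y hy => by
    simp [d1 hy]
  unfold expr
  rw [(d2.eventuallyEq_of_mem (Ioo_mem_nhds hx.1 hx.2)).deriv_eq]
  simp

lemma ker_incl_le {ε : ℝ} (hε : 0 < ε) :
    LinearMap.ker (incl hε) ≤ LinearMap.ker (exprMap hε) := by
  intro f hf
  have h0 : (f : ℝ → ℂ) =ᵐ[wMeasure ε] 0 :=
    (MemLp.coeFn_toLp (smooth_memLp hε f.2)).symm.trans (Lp.eq_zero_iff_ae_eq_zero.1 hf)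
  have h1 := ae_eq_zero_imp (f.2.1.continuousOn.mono Ioo_subset_Icc_self) h0
  have h2 : expr ε f =ᵐ[wMeasure ε] 0 := ae_wMeasure fun x hx => expr_eq_zero ε h1 hx
  exact Lp.eq_zero_iff_ae_eq_zero.2 ((MemLp.coeFn_toLp (expr_memLp hε f.2)).trans h2)

/-- The Sturm–Liouville operator `L f = -w⁻¹ (p f')'` as an unbounded operator in
`L²((0,1), w dx)` with domain `C₀^∞([0,1])`. -/
def L {ε : ℝ} (hε : 0 < ε) : H ε →ₗ.[ℂ] H ε where
  domain := LinearMap.range (incl hε)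
  toFun := (LinearMap.ker (incl hε)).liftQ (exprMap hε) (ker_incl_le hε) ∘ₗ
    (incl hε).quotKerEquivRange.symm.toLinearMap

/-- `L` sends the class of `f ∈ C₀^∞([0,1])` to the class of `-w⁻¹ (p f')'`. -/
lemma L_apply {ε : ℝ} (hε : 0 < ε) (f : smoothZero) :
    L hε ⟨incl hε f, LinearMap.mem_range_self _ f⟩ = exprMap hε f := by
  change (LinearMap.ker (incl hε)).liftQ (exprMap hε) (ker_incl_le hε)
    ((incl hε).quotKerEquivRange.symm ⟨incl hε f, LinearMap.mem_range_self _ f⟩) = _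
  rw [LinearMap.quotKerEquivRange_symm_apply_image (incl hε) f (LinearMap.mem_range_self _ f)]
  simp

/-- `u` is an eigenvector of the unbounded operator `T` with eigenvalue `μ`. -/
def IsEigenvector {E : Type*} [AddCommGroup E] [Module ℂ E] (T : E →ₗ.[ℂ] E) (μ : ℂ) (u : E) :
    Prop :=
  u ≠ 0 ∧ ∃ hu : u ∈ T.domain, T ⟨u, hu⟩ = μ • u

end

end SturmLiouville

/-! On the domain, `L f = g` is solved by two integrations. Since `p` vanishes at `1`, so does `p
f'`, hence `p f' (y) = ∫ᵧ¹ g w`; then `f 0 = 0` gives `f x = ∫₀ˣ p⁻¹ ∫ᵧ¹ g w`. Let `T h x = ∫₀ˣ h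
p⁻¹`, from `L²(p⁻¹ dx)` to `L²(w dx)` (`primOp`). The inner integral is `T* g`
(`coeFn_adjoint_primOp`), so the inverse is `T T*` (`greenOp`), which is visibly symmetric and
positive. Moreover `T` is Hilbert–Schmidt: `T h x` pairs `h` with the indicator of `(0,x)`, whose
squared norm `∫₀ˣ p⁻¹` is at most a constant times `x (1-x)^(-1/ε)`, and `w` compensates exactly
this growth. Thus `T T*` is compact. It is also injective, so the spectral theorem gives an
orthonormal eigenbasis, and the `μ n` are the reciprocals of its eigenvalues.

The domain contains only functions smooth up to both endpoints, so the eigenvectors of `T T*` must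
be shown to be that regular. Cauchy–Schwarz gives the growth `√(x (1-x)^(-1/ε))`; feeding it back
into the integral equation gains half a power of `1-x` per round and ends with `‖F x‖ ≤ C x`
(`exists_linear_bound`). Near `0`, `F x / x` is an average of `F'`, so `w F` is as smooth as `F'`,
and the equation then gives `F'` one more derivative. Near `1`, rescaling the tail integral makes
the powers of `1-y` cancel against `p⁻¹`, and `F` gains a derivative in the same way.

Conversely `T T*` undoes `L` on its domain (`greenOp_exprMap`). An eigenvector of `L` with an
eigenvalue outside the list would be orthogonal to the whole basis, hence zero. -/

namespace SturmLiouville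

/-! ### Hilbert–Schmidt and Carleman operators -/

/-- A bounded operator whose values on a Hilbert basis are square summable is compact. -/
theorem isCompactOperator_of_summable_norm_sq {ι E F : Type*} [NormedAddCommGroup E]
    [InnerProductSpace ℂ E] [NormedAddCommGroup F] [InnerProductSpace ℂ F] [CompleteSpace F]
    (b : HilbertBasis ι ℂ E) (T : E →L[ℂ] F) (hT : Summable fun i => ‖T (b i)‖ ^ 2) :
    IsCompactOperator T := by
  classical
  -- Finite-rank truncations; they converge to `T` in norm because the tails of the Hilbert–Schmidt
  -- sum tend to zero.
  let S : Finset ι → E →L[ℂ] F := fun s => ∑ i ∈ s, (innerSL ℂ (b i)).smulRight (T (b i))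
  have hS : ∀ s, IsCompactOperator (S s) := by
    intro s
    have : S s ∈ compactOperator (RingHom.id ℂ) E F := by
      refine Submodule.sum_mem _ fun i _ => ?_
      change IsCompactOperator ((innerSL ℂ (b i)).smulRight (T (b i)))
      have h1 : IsCompactOperator (innerSL ℂ (b i)) :=
        isCompactOperator_of_locallyCompactSpace_dom _
      exact h1.clm_comp (ContinuousLinearMap.toSpanSingleton ℂ (T (b i)))
    exact this
  have hbound : ∀ s, ‖S s - T‖ ≤ √((∑' i, ‖T (b i)‖ ^ 2) - ∑ i ∈ s, ‖T (b i)‖ ^ 2) := by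
    intro s
    refine ContinuousLinearMap.opNorm_le_bound _ (Real.sqrt_nonneg _) fun x => ?_
    have h1 : HasSum (fun i => inner ℂ (b i) x • T (b i)) (T x) := by
      have := (b.hasSum_repr x).mapL T
      simpa [HilbertBasis.repr_apply_apply] using this
    -- Approximating `T x` by finite partial sums reduces the norm bound to Cauchy–Schwarz and
    -- Bessel for finite sums over `t \ s`.
    have h2 : Tendsto (fun t : Finset ι => ‖∑ i ∈ s, inner ℂ (b i) x • T (b i)
        - ∑ i ∈ t, inner ℂ (b i) x • T (b i)‖) atTop (𝓝 ‖(S s - T) x‖) := by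
      have := (tendsto_const_nhds (x := ∑ i ∈ s, inner ℂ (b i) x • T (b i))).sub h1
      simpa [S] using this.norm
    refine le_of_tendsto h2 ?_
    filter_upwards [eventually_ge_atTop s] with t ht
    rw [norm_sub_rev, ← Finset.sum_sdiff ht, add_sub_cancel_right]
    have h3 : ∑ i ∈ t \ s, ‖inner ℂ (b i) x‖ ^ 2 ≤ ‖x‖ ^ 2 :=
      b.orthonormal.sum_inner_products_le x
    have h4 : ∑ i ∈ t \ s, ‖T (b i)‖ ^ 2
        ≤ (∑' i, ‖T (b i)‖ ^ 2) - ∑ i ∈ s, ‖T (b i)‖ ^ 2 := by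
      have := hT.sum_le_tsum t (fun i _ => sq_nonneg _)
      rw [← Finset.sum_sdiff ht] at this
      linarith
    calc ‖∑ i ∈ t \ s, inner ℂ (b i) x • T (b i)‖
        ≤ ∑ i ∈ t \ s, ‖T (b i)‖ * ‖inner ℂ (b i) x‖ := by
          refine (norm_sum_le _ _).trans (Finset.sum_le_sum fun i _ => ?_)
          rw [norm_smul, mul_comm]
      _ ≤ √(∑ i ∈ t \ s, ‖T (b i)‖ ^ 2) * √(∑ i ∈ t \ s, ‖inner ℂ (b i) x‖ ^ 2) :=
          Real.sum_mul_le_sqrt_mul_sqrt _ _ _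
      _ ≤ √((∑' i, ‖T (b i)‖ ^ 2) - ∑ i ∈ s, ‖T (b i)‖ ^ 2) * ‖x‖ := by
          gcongr
          rw [← Real.sqrt_sq (norm_nonneg x)]
          exact Real.sqrt_le_sqrt h3
  have hlim : Tendsto S atTop (𝓝 T) := by
    rw [tendsto_iff_norm_sub_tendsto_zero]
    refine squeeze_zero (fun _ => norm_nonneg _) hbound ?_
    have h1 : Tendsto (fun s : Finset ι => ∑ i ∈ s, ‖T (b i)‖ ^ 2) atTop
        (𝓝 (∑' i, ‖T (b i)‖ ^ 2)) := hT.hasSum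
    have := (h1.const_sub (∑' i, ‖T (b i)‖ ^ 2)).sqrt
    simpa using this
  exact isCompactOperator_of_tendsto hlim (Eventually.of_forall hS)

section Carleman

variable {X E : Type*} [MeasurableSpace X] {μ : Measure X} [NormedAddCommGroup E]
  [InnerProductSpace ℂ E] {a : X → E} {c : X → ℝ}

lemma memLp_inner_of_norm_le (hm : ∀ h, AEStronglyMeasurable (fun x => inner ℂ (a x) h) μ)
    (hc : MemLp c 2 μ) (hac : ∀ᵐ x ∂μ, ‖a x‖ ≤ c x) (h : E) :
    MemLp (fun x => inner ℂ (a x) h) 2 μ := by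
  refine (hc.const_mul ‖h‖).mono (hm h) ?_
  filter_upwards [hac] with x hx
  rw [norm_mul, norm_norm, mul_comm]
  exact (norm_inner_le_norm _ _).trans
    (mul_le_mul_of_nonneg_right (hx.trans (le_abs_self _)) (norm_nonneg _))

/-- The bounded operator `h ↦ (x ↦ ⟪a x, h⟫)` with values in `L²(μ)`, for a family of vectors
whose norms are dominated by a square integrable function. -/
noncomputable def carleman (hm : ∀ h, AEStronglyMeasurable (fun x => inner ℂ (a x) h) μ)
    (hc : MemLp c 2 μ) (hac : ∀ᵐ x ∂μ, ‖a x‖ ≤ c x) : E →L[ℂ] Lp ℂ 2 μ :=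
  LinearMap.mkContinuous
    { toFun := fun h => (memLp_inner_of_norm_le hm hc hac h).toLp
      map_add' := fun g h => by
        rw [← MemLp.toLp_add, MemLp.toLp_eq_toLp_iff]
        exact Eventually.of_forall fun x => by simp
      map_smul' := fun r h => by
        rw [RingHom.id_apply, ← MemLp.toLp_const_smul, MemLp.toLp_eq_toLp_iff]
        exact Eventually.of_forall fun x => by simp }
    ‖hc.toLp‖ fun h => by
      rw [mul_comm]
      refine Lp.norm_le_mul_norm_of_ae_le_mul ?_
      filter_upwards [(memLp_inner_of_norm_le hm hc hac h).coeFn_toLp, hc.coeFn_toLp, hac]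
        with x h1 h2 h3
      simp only [LinearMap.coe_mk, AddHom.coe_mk]
      rw [h1, h2, mul_comm]
      exact (norm_inner_le_norm _ _).trans
        (mul_le_mul_of_nonneg_right (h3.trans (le_abs_self _)) (norm_nonneg _))

variable (hm : ∀ h, AEStronglyMeasurable (fun x => inner ℂ (a x) h) μ)
    (hc : MemLp c 2 μ) (hac : ∀ᵐ x ∂μ, ‖a x‖ ≤ c x)

lemma coeFn_carleman (h : E) : carleman hm hc hac h =ᵐ[μ] fun x => inner ℂ (a x) h :=
  (memLp_inner_of_norm_le hm hc hac h).coeFn_toLp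

/-- Bessel's inequality at each point bounds the sum of the `|⟪a x, b i⟫|²` by `‖a x‖² ≤ c x ^ 2`.
Integrating, the Hilbert–Schmidt norm squared is at most `∫ c²`. -/
theorem isCompactOperator_carleman [CompleteSpace E] : IsCompactOperator (carleman hm hc hac) := by
  obtain ⟨s, b, -⟩ := exists_hilbertBasis ℂ E
  refine isCompactOperator_of_summable_norm_sq b _ ?_
  refine summable_of_sum_le (c := ∫ x, c x ^ 2 ∂μ) (fun _ => sq_nonneg _) fun t => ?_
  have h0 : ∀ i, Integrable (fun x => ‖inner ℂ (a x) (b i)‖ ^ 2) μ := fun i =>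
    (memLp_inner_of_norm_le hm hc hac (b i)).integrable_norm_pow (by norm_num)
  have h1 : ∀ i, ‖carleman hm hc hac (b i)‖ ^ 2 = ∫ x, ‖inner ℂ (a x) (b i)‖ ^ 2 ∂μ := by
    intro i
    have h2 : (‖carleman hm hc hac (b i)‖ ^ 2 : ℂ)
        = ((∫ x, ‖inner ℂ (a x) (b i)‖ ^ 2 ∂μ : ℝ) : ℂ) := by
      have := inner_self_eq_norm_sq_to_K (𝕜 := ℂ) (carleman hm hc hac (b i))
      simp only [Complex.coe_algebraMap] at this
      rw [← this, L2.inner_def, ← integral_complex_ofReal]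
      refine integral_congr_ae ?_
      filter_upwards [coeFn_carleman hm hc hac (b i)] with x hx
      rw [hx]
      simp
    exact_mod_cast h2
  simp_rw [h1]
  rw [← integral_finsetSum _ fun i _ => h0 i]
  refine integral_mono_ae (integrable_finsetSum _ fun i _ => h0 i) hc.integrable_sq ?_
  filter_upwards [hac] with x hx
  calc ∑ i ∈ t, ‖inner ℂ (a x) (b i)‖ ^ 2 = ∑ i ∈ t, ‖inner ℂ (b i) (a x)‖ ^ 2 := by
        simp_rw [norm_inner_symm]
    _ ≤ ‖a x‖ ^ 2 := b.orthonormal.sum_inner_products_le _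
    _ ≤ c x ^ 2 := by gcongr

end Carleman

/-! ### Ordered eigenbases of compact positive operators -/

/-- A function on an infinite type with finite sublevel sets can be listed in increasing order. -/
theorem exists_monotone_enumeration {ι : Type*} [Infinite ι] (g : ι → ℝ)
    (hg : ∀ M, {i | g i ≤ M}.Finite) : ∃ e : ℕ ≃ ι, Monotone (g ∘ e) := by
  classical
  have hc : Countable ι := by
    have : (univ : Set ι) = ⋃ n : ℕ, {i | g i ≤ n} := by
      ext i
      simpa using exists_nat_ge (g i)
    rw [← countable_univ_iff, this]
    exact countable_iUnion fun n => (hg n).countable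
  obtain ⟨r, hr⟩ := exists_injective_nat ι
  -- Ties of `g` are broken by the injection `r`. This gives a strict total order with finite
  -- initial segments, so counting predecessors is injective.
  let lt : ι → ι → Prop := fun j i => g j < g i ∨ (g j = g i ∧ r j < r i)
  have lt_trans : ∀ {a b c}, lt a b → lt b c → lt a c := by
    intro a b c h1 h2
    rcases h1 with h1 | ⟨h1, h1'⟩ <;> rcases h2 with h2 | ⟨h2, h2'⟩
    · exact Or.inl (h1.trans h2)
    · exact Or.inl (h2 ▸ h1)
    · exact Or.inl (h1 ▸ h2)
    · exact Or.inr ⟨h1.trans h2, h1'.trans h2'⟩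
  have fin : ∀ i, {j | lt j i}.Finite := fun i =>
    (hg (g i)).subset fun j hj => hj.elim (fun h => h.le) (fun h => h.1.le)
  let rank : ι → ℕ := fun i => {j | lt j i}.ncard
  have rank_lt : ∀ {i j}, lt i j → rank i < rank j := by
    intro i j h
    refine ncard_lt_ncard ⟨fun k hk => lt_trans hk h, fun hs => ?_⟩ (fin j)
    have : lt i i := hs h
    simp [lt] at this
  have rank_inj : Function.Injective rank := by
    intro i j hij
    by_contra hne
    have hrr : r i ≠ r j := fun h => hne (hr h)
    rcases lt_trichotomy (g i) (g j) with h | h | h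
    · exact (rank_lt (Or.inl h)).ne hij
    · rcases lt_or_gt_of_ne hrr with h' | h'
      · exact (rank_lt (Or.inr ⟨h, h'⟩)).ne hij
      · exact (rank_lt (Or.inr ⟨h.symm, h'⟩)).ne' hij
    · exact (rank_lt (Or.inl h)).ne' hij
  have : Infinite (range rank) := infinite_coe_iff.2 (infinite_range_of_injective rank_inj)
  -- Re-indexing the infinite range of `rank` by `ℕ` makes surjectivity of `rank` unnecessary.
  let e : ℕ ≃ ι := (Nat.Subtype.orderIsoOfNat (range rank)).toEquiv.trans
    (Equiv.ofInjective rank rank_inj).symm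
  have he : ∀ n, rank (e n) = Nat.Subtype.orderIsoOfNat (range rank) n := fun n =>
    Equiv.apply_ofInjective_symm rank_inj _
  refine ⟨e, fun m n hmn => ?_⟩
  by_contra! h
  have h1 : rank (e n) < rank (e m) := rank_lt (Or.inl h)
  rw [he, he] at h1
  exact absurd ((Nat.Subtype.orderIsoOfNat (range rank)).monotone hmn) (not_le.2 h1)

/-- An orthonormal family of eigenvectors of a compact operator has only finitely many members
whose eigenvalue has modulus at least `c > 0`. -/
theorem finite_setOf_le_norm_eigenvalue {ι H : Type*} [NormedAddCommGroup H]
    [InnerProductSpace ℂ H] {K : H →L[ℂ] H} (hK : IsCompactOperator K) {v : ι → H}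
    (hv : Orthonormal ℂ v) {l : ι → ℂ} (hl : ∀ i, K (v i) = l i • v i) {c : ℝ} (hc : 0 < c) :
    {i | c ≤ ‖l i‖}.Finite := by
  by_contra hinf
  let e := (Set.not_finite.1 hinf : Set.Infinite _).natEmbedding
  obtain ⟨C, hC, hsub⟩ := IsCompactOperator.image_closedBall_subset_compact
    (f := (K : H →ₗ[ℂ] H)) hK 1
  have hmem : ∀ n, K (v (e n)) ∈ C := fun n =>
    hsub ⟨v (e n), by simp [hv.1], rfl⟩
  obtain ⟨x, -, φ, hφ, hlim⟩ := hC.tendsto_subseq hmem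
  obtain ⟨N, hN⟩ := Metric.cauchySeq_iff'.1 hlim.cauchySeq c hc
  have h1 := hN (N + 1) (Nat.le_succ N)
  have hne : (e (φ (N + 1)) : ι) ≠ e (φ N) := fun h =>
    (hφ (Nat.lt_succ_self N)).ne' (e.injective (Subtype.ext h))
  -- By orthogonality, pairing the difference of two images with one of the eigenvectors isolates
  -- its eigenvalue. The images therefore stay at distance at least `c`, so no subsequence is
  -- Cauchy.
  have h2 : inner ℂ (v (e (φ (N + 1)))) (K (v (e (φ (N + 1)))) - K (v (e (φ N))))
      = l (e (φ (N + 1))) := by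
    rw [hl, hl, inner_sub_right, inner_smul_right, inner_smul_right, hv.2 hne,
      inner_self_eq_norm_sq_to_K, hv.1]
    simp
  have h3 := norm_inner_le_norm (𝕜 := ℂ) (v (e (φ (N + 1))))
    (K (v (e (φ (N + 1)))) - K (v (e (φ N))))
  rw [h2, hv.1, one_mul, ← dist_eq_norm] at h3
  exact absurd (((e (φ (N + 1))).2 : c ≤ _).trans h3) (not_le.2 h1)

open Module.End in
/-- Diagonalization of a compact positive injective operator by a sequence. -/
theorem exists_eigenbasis_of_isCompactOperator {H : Type*} [NormedAddCommGroup H]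
    [InnerProductSpace ℂ H] [CompleteSpace H] {K : H →L[ℂ] H} (hK : IsCompactOperator K)
    (hs : (K : H →ₗ[ℂ] H).IsSymmetric) (hpos : ∀ x, 0 ≤ (inner ℂ x (K x)).re)
    (hinj : ∀ x, K x = 0 → x = 0) (hinf : ¬ FiniteDimensional ℂ H) :
    ∃ (f : ℕ → H) (μ : ℕ → ℝ), Orthonormal ℂ f ∧
      (Submodule.span ℂ (range f)).topologicalClosure = ⊤ ∧
      (∀ n, K (f n) = ((μ n)⁻¹ : ℂ) • f n) ∧ (∀ n, 0 < μ n) ∧ Monotone μ ∧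
      Tendsto μ atTop atTop := by
  classical
  have hfin : ∀ z : ℂ, FiniteDimensional ℂ (eigenspace (K : H →ₗ[ℂ] H) z) := by
    intro z
    rcases eq_or_ne z 0 with rfl | hz
    · have : eigenspace (K : H →ₗ[ℂ] H) 0 = ⊥ := by
        rw [eigenspace_zero, LinearMap.ker_eq_bot']
        exact hinj
      rw [this]
      infer_instance
    · exact ContinuousLinearMap.finite_dimensional_eigenspace hK z hz
  -- The first component ranges over all of `ℂ`; numbers that are not eigenvalues contribute an
  -- empty fibre.
  let ι := Σ z : ℂ, Fin (Module.finrank ℂ (eigenspace (K : H →ₗ[ℂ] H) z))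
  let b : ∀ z : ℂ, OrthonormalBasis (Fin (Module.finrank ℂ (eigenspace (K : H →ₗ[ℂ] H) z))) ℂ
      (eigenspace (K : H →ₗ[ℂ] H) z) := fun z => stdOrthonormalBasis ℂ _
  let v : ι → H := fun i => (b i.1 i.2 : H)
  have hv : Orthonormal ℂ v :=
    hs.orthogonalFamily_eigenspaces.orthonormal_sigma_orthonormal fun z => (b z).orthonormal
  have hKv : ∀ i, K (v i) = i.1 • v i := fun i => mem_eigenspace_iff.1 (b i.1 i.2).2
  have hspan : (Submodule.span ℂ (range v)).topologicalClosure = ⊤ := by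
    rw [Submodule.topologicalClosure_eq_top_iff, eq_bot_iff,
      ← ContinuousLinearMap.orthogonalComplement_iSup_eigenspaces_eq_bot hK hs]
    refine Submodule.orthogonal_le (iSup_le fun z => ?_)
    have h1 : Submodule.map (eigenspace (K : H →ₗ[ℂ] H) z).subtype
        (Submodule.span ℂ (range (b z))) = eigenspace (K : H →ₗ[ℂ] H) z := by
      rw [← OrthonormalBasis.coe_toBasis, (b z).toBasis.span_eq, Submodule.map_top,
        Submodule.range_subtype]
    rw [← h1, Submodule.map_span_le]
    rintro _ ⟨j, rfl⟩
    exact Submodule.subset_span ⟨⟨z, j⟩, rfl⟩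
  have hval : ∀ i : ι, ((i.1.re : ℝ) : ℂ) = i.1 ∧ 0 < i.1.re := by
    intro i
    have hne : v i ≠ 0 := hv.ne_zero i
    have hev : HasEigenvalue (K : H →ₗ[ℂ] H) i.1 :=
      hasEigenvalue_of_hasEigenvector ⟨(b i.1 i.2).2, hne⟩
    have h1 : ((i.1.re : ℝ) : ℂ) = i.1 :=
      Complex.conj_eq_iff_re.1 (hs.conj_eigenvalue_eq_self hev)
    refine ⟨h1, lt_of_le_of_ne ?_ fun h0 => hne (hinj _ ?_)⟩
    · have := hpos (v i)
      rw [hKv, inner_smul_right, inner_self_eq_norm_sq_to_K, hv.1] at this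
      simpa using this
    · rw [hKv, ← h1, ← h0]
      simp
  let g : ι → ℝ := fun i => (i.1.re)⁻¹
  have hg : ∀ M, {i | g i ≤ M}.Finite := by
    intro M
    -- The maximum with `1` keeps the threshold positive when `M ≤ 0`.
    refine (finite_setOf_le_norm_eigenvalue hK hv hKv
      (c := (max M 1)⁻¹) (by positivity)).subset fun i hi => ?_
    have h1 : (max M 1)⁻¹ ≤ i.1.re :=
      inv_le_of_inv_le₀ (hval i).2 (le_trans hi (le_max_left _ _))
    exact h1.trans (Complex.re_le_norm _)
  have hι : Infinite ι := by
    by_contra hfι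
    have : Finite ι := not_infinite_iff_finite.1 hfι
    have h1 : FiniteDimensional ℂ (Submodule.span ℂ (range v)) :=
      FiniteDimensional.span_of_finite ℂ (finite_range v)
    rw [(Submodule.closed_of_finiteDimensional _).submodule_topologicalClosure_eq] at hspan
    rw [hspan] at h1
    exact hinf (Module.Finite.equiv (Submodule.topEquiv (R := ℂ) (M := H)))
  obtain ⟨e, he⟩ := exists_monotone_enumeration g hg
  refine ⟨v ∘ e, g ∘ e, hv.comp e e.injective, ?_, fun n => ?_, fun n => ?_, he, ?_⟩
  · rw [e.surjective.range_comp]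
    exact hspan
  · simp only [Function.comp, g]
    rw [hKv, Complex.ofReal_inv, inv_inv, (hval _).1]
  · exact inv_pos.2 (hval _).2
  · refine tendsto_atTop_atTop_of_monotone he fun M => ?_
    by_contra! h
    refine infinite_univ (α := ℕ) (((hg M).preimage (e.injective.injOn)).subset fun n _ => ?_)
    exact (h n).le

/-! ### Measures with a density on the unit interval -/

section Density

variable {d : ℝ → ℝ}

/-- The measure `d(x) dx` on the interval `(0,1)`. -/
noncomputable abbrev densityMeasure (d : ℝ → ℝ) : Measure ℝ :=
  (volume.restrict (Ioo (0 : ℝ) 1)).withDensity fun x => ENNReal.ofReal (d x)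

lemma integrableOn_densityMeasure_iff {E : Type*} [NormedAddCommGroup E] [NormedSpace ℝ E]
    (hd : Measurable d) (h0 : ∀ x ∈ Ioo (0 : ℝ) 1, 0 ≤ d x) {S : Set ℝ} (hS : MeasurableSet S)
    (hS1 : S ⊆ Ioo 0 1) {g : ℝ → E} :
    IntegrableOn g S (densityMeasure d) ↔ IntegrableOn (fun x => d x • g x) S := by
  rw [IntegrableOn, restrict_withDensity hS, integrable_withDensity_iff_integrable_smul'
    hd.ennreal_ofReal (by simp), Measure.restrict_restrict hS, inter_eq_left.2 hS1, ← IntegrableOn]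
  refine integrableOn_congr_fun (fun x hx => ?_) hS
  rw [ENNReal.toReal_ofReal (h0 x (hS1 hx))]

lemma setIntegral_densityMeasure {E : Type*} [NormedAddCommGroup E] [NormedSpace ℝ E]
    (hd : Measurable d) (h0 : ∀ x ∈ Ioo (0 : ℝ) 1, 0 ≤ d x) {S : Set ℝ} (hS : MeasurableSet S)
    (hS1 : S ⊆ Ioo 0 1) (g : ℝ → E) :
    ∫ x in S, g x ∂(densityMeasure d) = ∫ x in S, d x • g x := by
  rw [restrict_withDensity hS, integral_withDensity_eq_integral_toReal_smul
    hd.ennreal_ofReal (by simp), Measure.restrict_restrict hS, inter_eq_left.2 hS1]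
  refine setIntegral_congr_fun hS (fun x hx => ?_)
  rw [ENNReal.toReal_ofReal (h0 x (hS1 hx))]

lemma memLp_densityMeasure {E : Type*} [NormedAddCommGroup E] [NormedSpace ℝ E]
    (hd : Measurable d) (h0 : ∀ x ∈ Ioo (0 : ℝ) 1, 0 ≤ d x) {g : ℝ → E}
    (hg : ContinuousOn g (Ioo 0 1)) {b : ℝ → ℝ} (hb : IntegrableOn b (Ioo 0 1))
    (hle : ∀ x ∈ Ioo (0 : ℝ) 1, d x * ‖g x‖ ^ 2 ≤ b x) : MemLp g 2 (densityMeasure d) := by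
  have hm : AEStronglyMeasurable g (densityMeasure d) :=
    (hg.aestronglyMeasurable measurableSet_Ioo).mono_ac (withDensity_absolutelyContinuous _ _)
  rw [memLp_two_iff_integrable_sq_norm hm, integrable_withDensity_iff_integrable_smul'
    hd.ennreal_ofReal (by simp)]
  refine Integrable.mono' hb ?_ ?_
  · exact ((hd.ennreal_ofReal.ennreal_toReal).aestronglyMeasurable).smul
      ((hg.aestronglyMeasurable measurableSet_Ioo).norm.pow 2)
  · refine (ae_restrict_iff' measurableSet_Ioo).2 (Eventually.of_forall fun x hx => ?_)
    rw [ENNReal.toReal_ofReal (h0 x hx), smul_eq_mul, Real.norm_of_nonneg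
      (mul_nonneg (h0 x hx) (sq_nonneg _))]
    exact hle x hx

/-- Strict positivity of the density makes its null sets the Lebesgue null sets of the interval. -/
lemma ae_densityMeasure_iff (hd : Measurable d) (h0 : ∀ x ∈ Ioo (0 : ℝ) 1, 0 < d x)
    {P : ℝ → Prop} : (∀ᵐ x ∂(densityMeasure d), P x) ↔ ∀ᵐ x, x ∈ Ioo (0 : ℝ) 1 → P x := by
  rw [ae_withDensity_iff hd.ennreal_ofReal, ae_restrict_iff' measurableSet_Ioo]
  refine eventually_congr (Eventually.of_forall fun x => ?_)
  refine forall_congr' fun hx => ?_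
  simp [h0 x hx]

instance (d : ℝ → ℝ) : SigmaFinite (densityMeasure d) :=
  SigmaFinite.withDensity_of_ne_top (by simp)

end Density

/-! ### Estimates for the coefficients -/

lemma p_pos (ε : ℝ) {x : ℝ} (hx : x ∈ Ioo (0 : ℝ) 1) : 0 < p ε x := by
  have h1 : 0 < 1 - x := by linarith [hx.2]
  have h2 : 0 < x + 1 := by linarith [hx.1]
  unfold p
  positivity

lemma measurable_w (ε : ℝ) : Measurable (w ε) := by unfold w; fun_prop

lemma measurable_inv_p (ε : ℝ) : Measurable fun x => (p ε x)⁻¹ := by unfold p; fun_prop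

lemma inv_p_nonneg (ε : ℝ) : ∀ x ∈ Ioo (0 : ℝ) 1, 0 ≤ (p ε x)⁻¹ :=
  fun _ hx => (inv_pos.2 (p_pos ε hx)).le

lemma continuousOn_p (ε : ℝ) : ContinuousOn (p ε) (Ioo (-1) 1) := by
  intro x hx
  have h1 : 1 - x ≠ 0 := by linarith [hx.2]
  have h2 : x + 1 ≠ 0 := by linarith [hx.1]
  unfold p
  exact (((continuousAt_const.sub continuousAt_id).rpow_const (Or.inl h1)).mul
    ((continuousAt_id.add continuousAt_const).rpow_const (Or.inl h2))).continuousWithinAt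

lemma inv_p_eq (ε : ℝ) {x : ℝ} (hx : x ∈ Ioo (-1 : ℝ) 1) :
    (p ε x)⁻¹ = (1 - x) ^ (-(1 / ε) - 1) * (1 + x) ^ (1 / ε - 1) := by
  have h1 : 0 < 1 - x := by linarith [hx.2]
  have h2 : 0 < x + 1 := by linarith [hx.1]
  rw [p, mul_inv, ← Real.rpow_neg h1.le, ← Real.rpow_neg h2.le, add_comm x 1]
  congr 2 <;> ring

lemma inv_p_le {ε : ℝ} (hε : 0 < ε) {x : ℝ} (hx : x ∈ Ico (0 : ℝ) 1) :
    (p ε x)⁻¹ ≤ 2 ^ (1 / ε) * (1 - x) ^ (-(1 / ε) - 1) := by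
  have h1 : 0 < 1 - x := by linarith [hx.2]
  have ha : 0 < 1 / ε := by positivity
  rw [inv_p_eq ε ⟨by linarith [hx.1], hx.2⟩, mul_comm]
  gcongr
  -- The exponent `1 / ε - 1` may be negative, so it is first raised to `1 / ε`, which is allowed
  -- since the base is at least `1`.
  calc (1 + x) ^ (1 / ε - 1) ≤ (1 + x) ^ (1 / ε) :=
        Real.rpow_le_rpow_of_exponent_le (by linarith [hx.1]) (by linarith)
    _ ≤ 2 ^ (1 / ε) := Real.rpow_le_rpow (by linarith [hx.1]) (by linarith [hx.2]) ha.le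

/-- This primitive already carries the factor `x` needed at `0`. The extra factor `1 - x + a * x` is
a convex combination of `1` and `a` on `[0,1]`, hence at least `min 1 a`. -/
lemma hasDerivAt_mul_one_sub_rpow (a : ℝ) {x : ℝ} (hx : x < 1) :
    HasDerivAt (fun y => y * (1 - y) ^ (-a)) ((1 - x) ^ (-a - 1) * (1 - x + a * x)) x := by
  have h1 : 0 < 1 - x := by linarith
  have := (hasDerivAt_id x).mul
    (((hasDerivAt_id x).const_sub 1).rpow_const (p := -a) (Or.inl h1.ne'))
  refine this.congr_deriv ?_
  simp only [id]
  rw [show (1 - x) ^ (-a) = (1 - x) ^ (-a - 1) * (1 - x) by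
    rw [← Real.rpow_add_one h1.ne']; ring_nf]
  ring

/-- `∫₀ˣ (1-y)^{-a-1} dy ≤ C x (1-x)^{-a}`. -/
lemma integral_one_sub_rpow_le {a : ℝ} (ha : 0 < a) {x : ℝ} (hx : x ∈ Ico (0 : ℝ) 1) :
    ∫ y in (0 : ℝ)..x, (1 - y) ^ (-a - 1) ≤ (min 1 a)⁻¹ * (x * (1 - x) ^ (-a)) := by
  have hpos : ∀ y ∈ uIcc 0 x, 0 < 1 - y := by
    intro y hy
    rw [uIcc_of_le hx.1] at hy
    linarith [hy.2, hx.2]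
  have hc : ∀ b : ℝ, ContinuousOn (fun y : ℝ => (1 - y) ^ b) (uIcc 0 x) := fun b y hy =>
    ((continuousAt_const.sub continuousAt_id).rpow_const
      (Or.inl (hpos y hy).ne')).continuousWithinAt
  have hd : ∫ y in (0 : ℝ)..x, (1 - y) ^ (-a - 1) * (1 - y + a * y) = x * (1 - x) ^ (-a) := by
    rw [intervalIntegral.integral_eq_sub_of_hasDerivAt (f := fun y => y * (1 - y) ^ (-a))
      (fun y hy => hasDerivAt_mul_one_sub_rpow a (by linarith [hpos y hy]))]
    · simp
    · exact ((hc _).mul (by fun_prop)).intervalIntegrable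
  rw [← hd, ← intervalIntegral.integral_const_mul]
  refine intervalIntegral.integral_mono_on hx.1 (hc _).intervalIntegrable
    (((hc _).mul (by fun_prop)).intervalIntegrable.const_mul _) fun y hy => ?_
  have hm : 0 < min 1 a := lt_min one_pos ha
  have h1 := hpos y (by rwa [uIcc_of_le hx.1])
  have h2 : min 1 a ≤ 1 - y + a * y := by
    nlinarith [min_le_left 1 a, min_le_right 1 a, hy.1]
  rw [mul_left_comm]
  refine le_mul_of_one_le_right (by positivity) ?_
  rw [inv_mul_eq_div, le_div_iff₀ hm]
  linarith

/-- The measure `p(x)⁻¹ dx` on the interval `(0,1)`. -/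
noncomputable abbrev pMeasure (ε : ℝ) : Measure ℝ := densityMeasure fun x => (p ε x)⁻¹

lemma integrableOn_inv_p (ε : ℝ) {x : ℝ} (hx : x < 1) :
    IntegrableOn (fun y => (p ε y)⁻¹) (Icc 0 x) := by
  refine ContinuousOn.integrableOn_Icc (ContinuousOn.inv₀ ((continuousOn_p ε).mono ?_) ?_)
  · exact fun y hy => ⟨by linarith [hy.1], by linarith [hy.2]⟩
  · intro y hy
    have h1 : 0 < 1 - y := by linarith [hy.2]
    have h2 : 0 < y + 1 := by linarith [hy.1]
    unfold p
    positivity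

/-- The constant in the bound for the primitive of `1 / p`. -/
noncomputable def primConst (ε : ℝ) : ℝ := 2 ^ (1 / ε) * (min 1 (1 / ε))⁻¹

lemma primConst_nonneg {ε : ℝ} (hε : 0 < ε) : 0 ≤ primConst ε := by
  have : 0 < min 1 (1 / ε) := lt_min one_pos (by positivity)
  unfold primConst
  positivity

lemma pMeasure_Ioo_lt_top (ε : ℝ) {x : ℝ} (hx : x < 1) : pMeasure ε (Ioo 0 x) < ⊤ := by
  have hsub : Ioo 0 x ⊆ Ioo 0 1 := Ioo_subset_Ioo_right hx.le
  have h : IntegrableOn (fun _ => (1 : ℝ)) (Ioo 0 x) (pMeasure ε) := by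
    rw [integrableOn_densityMeasure_iff (measurable_inv_p ε) (inv_p_nonneg ε) measurableSet_Ioo
      hsub]
    simpa using (integrableOn_inv_p ε hx).mono_set Ioo_subset_Icc_self
  simpa using h

lemma pMeasure_real_Ioo_le {ε : ℝ} (hε : 0 < ε) {x : ℝ} (hx : x ∈ Ico (0 : ℝ) 1) :
    (pMeasure ε).real (Ioo 0 x) ≤ primConst ε * (x * (1 - x) ^ (-(1 / ε))) := by
  have hsub : Ioo 0 x ⊆ Ioo 0 1 := Ioo_subset_Ioo_right hx.2.le
  have ha : 0 < 1 / ε := by positivity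
  have h : (pMeasure ε).real (Ioo 0 x) = ∫ y in Ioo 0 x, (p ε y)⁻¹ := by
    have := setIntegral_densityMeasure (measurable_inv_p ε) (inv_p_nonneg ε)
      measurableSet_Ioo hsub (fun _ => (1 : ℝ))
    simpa using this
  rw [h, ← integral_Ioc_eq_integral_Ioo, ← intervalIntegral.integral_of_le hx.1, primConst,
    mul_assoc]
  have hc : ContinuousOn (fun y : ℝ => (1 - y) ^ (-(1 / ε) - 1)) (uIcc 0 x) := fun y hy => by
    rw [uIcc_of_le hx.1] at hy
    exact ((continuousAt_const.sub continuousAt_id).rpow_const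
      (Or.inl (by linarith [hy.2, hx.2] : 1 - y ≠ 0))).continuousWithinAt
  calc ∫ y in (0 : ℝ)..x, (p ε y)⁻¹
      ≤ ∫ y in (0 : ℝ)..x, 2 ^ (1 / ε) * (1 - y) ^ (-(1 / ε) - 1) := by
        refine intervalIntegral.integral_mono_on hx.1 ?_ (hc.intervalIntegrable.const_mul _)
          fun y hy => inv_p_le hε ⟨hy.1, hy.2.trans_lt hx.2⟩
        exact (intervalIntegrable_iff_integrableOn_Icc_of_le hx.1).2 (integrableOn_inv_p ε hx.2)
    _ ≤ _ := by
        rw [intervalIntegral.integral_const_mul]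
        gcongr
        exact integral_one_sub_rpow_le ha hx

/-! ### The integration operator and its adjoint -/

/-- The right end point of the truncated interval: `x` for `x < 1`, and `0` otherwise. -/
noncomputable def cut (x : ℝ) : ℝ := if x < 1 then x else 0

lemma cut_lt_one (x : ℝ) : cut x < 1 := by
  unfold cut
  split_ifs with h
  · exact h
  · exact one_pos

lemma cut_of_lt {x : ℝ} (hx : x < 1) : cut x = x := if_pos hx

/-- The class in `L²((0,1), p⁻¹ dx)` of the indicator function of `(0,x)`. -/
noncomputable def stepLp (ε x : ℝ) : Lp ℂ 2 (pMeasure ε) :=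
  -- `p⁻¹` is not integrable up to `1`; `cut` keeps the interval of finite measure for every real
  -- `x`, so the family is total.
  indicatorConstLp 2 (measurableSet_Ioo (a := 0) (b := cut x))
    (pMeasure_Ioo_lt_top ε (cut_lt_one x)).ne 1

lemma inner_stepLp (ε x : ℝ) (h : Lp ℂ 2 (pMeasure ε)) :
    inner ℂ (stepLp ε x) h = ∫ y in Ioo 0 (cut x), h y ∂(pMeasure ε) :=
  L2.inner_indicatorConstLp_one _ _ _

/-- A square integrable majorant of the norm of `stepLp ε x`. -/
noncomputable def stepBound (ε x : ℝ) : ℝ := √(primConst ε * (x * (1 - x) ^ (-(1 / ε))))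

lemma sqrt_pMeasure_le {ε : ℝ} (hε : 0 < ε) {x : ℝ} (hx : x ∈ Ioo (0 : ℝ) 1) :
    √((pMeasure ε).real (Ioo 0 x)) ≤ stepBound ε x :=
  Real.sqrt_le_sqrt (pMeasure_real_Ioo_le hε ⟨hx.1.le, hx.2⟩)

lemma norm_stepLp_le {ε : ℝ} (hε : 0 < ε) {x : ℝ} (hx : x ∈ Ioo (0 : ℝ) 1) :
    ‖stepLp ε x‖ ≤ stepBound ε x := by
  unfold stepLp
  rw [norm_indicatorConstLp (by norm_num) (by norm_num), cut_of_lt hx.2, norm_one, one_mul]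
  refine le_trans (le_of_eq ?_) (sqrt_pMeasure_le hε hx)
  rw [Real.sqrt_eq_rpow]
  norm_num

/-- In `w * stepBound ^ 2` the factors `x` and `(1-x)^(1/ε)` cancel with their inverses, leaving at
most `primConst ε`. This cancellation is what makes the inverse operator compact. -/
lemma memLp_stepBound {ε : ℝ} (hε : 0 < ε) : MemLp (stepBound ε) 2 (wMeasure ε) := by
  have ha : 0 < 1 / ε := by positivity
  refine memLp_densityMeasure (measurable_w ε) (fun x hx => (w_pos ε hx).le)
    (b := fun _ => primConst ε) ?_ ?_ fun x hx => ?_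
  · unfold stepBound
    refine ContinuousOn.sqrt (continuousOn_const.mul (continuousOn_id.mul fun x hx => ?_))
    exact ((continuousAt_const.sub continuousAt_id).rpow_const
      (Or.inl (by linarith [hx.2] : 1 - x ≠ 0))).continuousWithinAt
  · exact integrableOn_const (by simp)
  · have h1 : 0 < 1 - x := by linarith [hx.2]
    have hx0 := hx.1
    have hp := primConst_nonneg hε
    rw [stepBound, Real.norm_eq_abs, sq_abs, Real.sq_sqrt (by positivity), w, Real.rpow_neg h1.le]
    have h2 : (x + 1) ^ (-(1 / ε)) ≤ 1 :=
      Real.rpow_le_one_of_one_le_of_nonpos (by linarith) (by linarith)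
    calc x⁻¹ * (1 - x) ^ (1 / ε) * (x + 1) ^ (-(1 / ε))
          * (primConst ε * (x * ((1 - x) ^ (1 / ε))⁻¹))
        = primConst ε * (x + 1) ^ (-(1 / ε)) := by
          field_simp
      _ ≤ primConst ε := mul_le_of_le_one_right hp h2

/-- The pairing is a partial integral of a jointly measurable function of `(x, y)`, so measurability
in `x` is part of Fubini's theorem. -/
lemma aestronglyMeasurable_inner_stepLp (ε : ℝ) (h : Lp ℂ 2 (pMeasure ε)) :
    AEStronglyMeasurable (fun x => inner ℂ (stepLp ε x) h) (wMeasure ε) := by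
  have hcut : Measurable cut := Measurable.ite measurableSet_Iio measurable_id measurable_const
  have hS : MeasurableSet {q : ℝ × ℝ | 0 < q.2 ∧ q.2 < cut q.1} :=
    (measurableSet_lt measurable_const measurable_snd).inter
      (measurableSet_lt measurable_snd (hcut.comp measurable_fst))
  have hm : StronglyMeasurable
      ({q : ℝ × ℝ | 0 < q.2 ∧ q.2 < cut q.1}.indicator fun q => h q.2) :=
    ((Lp.stronglyMeasurable h).comp_measurable measurable_snd).indicator hS
  have : (fun x => inner ℂ (stepLp ε x) h) = fun x => ∫ y,
      ({q : ℝ × ℝ | 0 < q.2 ∧ q.2 < cut q.1}.indicator fun q => h q.2) (x, y) ∂(pMeasure ε) := by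
    ext x
    rw [inner_stepLp, ← integral_indicator measurableSet_Ioo]
    rfl
  rw [this]
  exact hm.integral_prod_right'.aestronglyMeasurable

lemma ae_norm_stepLp_le {ε : ℝ} (hε : 0 < ε) : ∀ᵐ x ∂(wMeasure ε), ‖stepLp ε x‖ ≤ stepBound ε x :=
  ae_wMeasure fun _ hx => norm_stepLp_le hε hx

/-- The integration operator `h ↦ ∫₀ˣ h(y) p(y)⁻¹ dy` from `L²(p⁻¹ dx)` to `L²(w dx)`. -/
noncomputable def primOp {ε : ℝ} (hε : 0 < ε) : Lp ℂ 2 (pMeasure ε) →L[ℂ] H ε :=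
  carleman (aestronglyMeasurable_inner_stepLp ε) (memLp_stepBound hε) (ae_norm_stepLp_le hε)

lemma coeFn_primOp {ε : ℝ} (hε : 0 < ε) (h : Lp ℂ 2 (pMeasure ε)) :
    ∀ᵐ x ∂(wMeasure ε), primOp hε h x = ∫ y in Ioo 0 x, h y ∂(pMeasure ε) := by
  filter_upwards [coeFn_carleman (aestronglyMeasurable_inner_stepLp ε) (memLp_stepBound hε)
    (ae_norm_stepLp_le hε) h, ae_wMeasure (P := fun x => x ∈ Ioo (0 : ℝ) 1) fun _ hx => hx]
    with x h1 h2
  rw [primOp, h1, inner_stepLp, cut_of_lt h2.2]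

lemma ae_mem_pMeasure (ε : ℝ) : ∀ᵐ x ∂(pMeasure ε), x ∈ Ioo (0 : ℝ) 1 :=
  (withDensity_absolutelyContinuous _ _).ae_le (ae_restrict_mem measurableSet_Ioo)

instance (ε : ℝ) : SigmaFinite (wMeasure ε) :=
  inferInstanceAs (SigmaFinite (densityMeasure (w ε)))

/-- The integrand of the Fubini argument identifying the adjoint of `primOp`. -/
lemma integrable_prod_step {ε : ℝ} (hε : 0 < ε) (g : H ε) {S : Set ℝ} (hS : MeasurableSet S)
    (hS1 : pMeasure ε S < ⊤) :
    Integrable ({q : ℝ × ℝ | q.2 ∈ S ∧ 0 < q.2 ∧ q.2 < q.1 ∧ q.1 < 1}.indicator fun q => g q.1)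
      ((wMeasure ε).prod (pMeasure ε)) := by
  have hQ : MeasurableSet {q : ℝ × ℝ | q.2 ∈ S ∧ 0 < q.2 ∧ q.2 < q.1 ∧ q.1 < 1} :=
    (measurable_snd hS).inter ((measurableSet_lt measurable_const measurable_snd).inter
      ((measurableSet_lt measurable_snd measurable_fst).inter
        (measurableSet_lt measurable_fst measurable_const)))
  have hm := ((Lp.stronglyMeasurable g).comp_measurable
    (measurable_fst (β := ℝ))).indicator hQ
  have hsec : ∀ x ∈ Ioo (0 : ℝ) 1, ∀ y,
      ({q : ℝ × ℝ | q.2 ∈ S ∧ 0 < q.2 ∧ q.2 < q.1 ∧ q.1 < 1}.indicator fun q => g q.1) (x, y)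
        = (S ∩ Ioo 0 x).indicator (fun _ => g x) y := by
    intro x hx y
    classical
    simp only [indicator_apply, mem_ofPred_eq, mem_inter_iff, mem_Ioo, hx.2, and_true]
  have hfin : ∀ x, pMeasure ε (S ∩ Ioo 0 x) < ⊤ := fun x =>
    (measure_mono inter_subset_left).trans_lt hS1
  have hae : ∀ᵐ x ∂(wMeasure ε), x ∈ Ioo (0 : ℝ) 1 := ae_wMeasure fun _ hx => hx
  refine (integrable_prod_iff hm.aestronglyMeasurable).2 ⟨?_, ?_⟩
  · filter_upwards [hae] with x hx
    have : Integrable ((S ∩ Ioo 0 x).indicator (fun _ => g x)) (pMeasure ε) :=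
      (integrable_indicator_iff (hS.inter measurableSet_Ioo)).2
        (integrableOn_const (hfin x).ne)
    exact this.congr (Eventually.of_forall fun y => (hsec x hx y).symm)
  · have hint : Integrable (fun x => √((pMeasure ε).real S) * (‖g x‖ * stepBound ε x))
        (wMeasure ε) := by
      refine Integrable.const_mul ?_ _
      exact MemLp.integrable_mul (p := 2) (q := 2) (Lp.memLp g).norm (memLp_stepBound hε)
    refine hint.mono' hm.norm.integral_prod_right'.aestronglyMeasurable ?_
    filter_upwards [hae] with x hx
    have h1 : ∫ y, ‖({q : ℝ × ℝ | q.2 ∈ S ∧ 0 < q.2 ∧ q.2 < q.1 ∧ q.1 < 1}.indicator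
        fun q => g q.1) (x, y)‖ ∂(pMeasure ε) = (pMeasure ε).real (S ∩ Ioo 0 x) * ‖g x‖ := by
      simp_rw [hsec x hx, norm_indicator_eq_indicator_norm]
      rw [integral_indicator_const _ (hS.inter measurableSet_Ioo), smul_eq_mul]
    -- The measure of the intersection is at most each of the two measures, hence at most their
    -- geometric mean. This produces `stepBound`, which is integrable against `g`.
    have h2 : (pMeasure ε).real (S ∩ Ioo 0 x) ≤ √((pMeasure ε).real S) * stepBound ε x := by
      refine le_trans ?_ (mul_le_mul_of_nonneg_left (sqrt_pMeasure_le hε hx) (Real.sqrt_nonneg _))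
      rw [← Real.sqrt_mul measureReal_nonneg]
      refine Real.le_sqrt_of_sq_le ?_
      rw [sq]
      refine mul_le_mul ?_ ?_ measureReal_nonneg measureReal_nonneg
      · exact measureReal_mono inter_subset_left hS1.ne
      · exact measureReal_mono inter_subset_right (pMeasure_Ioo_lt_top ε hx.2).ne
    calc ‖∫ y, ‖({q : ℝ × ℝ | q.2 ∈ S ∧ 0 < q.2 ∧ q.2 < q.1 ∧ q.1 < 1}.indicator
        fun q => g q.1) (x, y)‖ ∂(pMeasure ε)‖ = (pMeasure ε).real (S ∩ Ioo 0 x) * ‖g x‖ := by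
          rw [h1, Real.norm_of_nonneg (by positivity)]
      _ ≤ √((pMeasure ε).real S) * stepBound ε x * ‖g x‖ := by gcongr
      _ = _ := by ring

/-- The adjoint of the integration operator is `g ↦ ∫ᵧ¹ g(x) w(x) dx`. -/
theorem coeFn_adjoint_primOp {ε : ℝ} (hε : 0 < ε) (g : H ε) :
    ∀ᵐ y ∂(pMeasure ε), (ContinuousLinearMap.adjoint (primOp hε) g) y
      = ∫ x in Ioo y 1, g x ∂(wMeasure ε) := by
  have hae : ∀ᵐ x ∂(wMeasure ε), x ∈ Ioo (0 : ℝ) 1 := ae_wMeasure fun _ hx => hx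
  have hsw : ∀ S : Set ℝ, ∀ y,
      ∫ x, ({q : ℝ × ℝ | q.2 ∈ S ∧ 0 < q.2 ∧ q.2 < q.1 ∧ q.1 < 1}.indicator fun q => g q.1) (x, y)
        ∂(wMeasure ε) = (S ∩ Ioi 0).indicator (fun y => ∫ x in Ioo y 1, g x ∂(wMeasure ε)) y := by
    intro S y
    by_cases hy : y ∈ S ∩ Ioi 0
    · rw [indicator_of_mem hy, ← integral_indicator measurableSet_Ioo]
      refine integral_congr_ae (Eventually.of_forall fun x => ?_)
      have h1 : y ∈ S := hy.1
      have h2 : 0 < y := hy.2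
      classical
      simp only [indicator_apply, mem_ofPred_eq, mem_Ioo, h1, h2, true_and]
    · rw [indicator_of_notMem hy]
      refine integral_eq_zero_of_ae (Eventually.of_forall fun x => ?_)
      refine indicator_of_notMem (fun hq => hy ⟨hq.1, hq.2.1⟩) _
  have hpos : ∀ S : Set ℝ, (S ∩ Ioi 0 : Set ℝ) =ᵐ[pMeasure ε] S := by
    intro S
    filter_upwards [ae_mem_pMeasure ε] with y hy
    have : y ∈ Ioi (0 : ℝ) := hy.1
    exact propext ⟨fun h => h.1, fun h => ⟨h, this⟩⟩
  -- Both sides are compared through their integrals over sets `S` of finite measure: pairing the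
  -- adjoint with the indicator of `S` moves `primOp` onto the indicator, and Fubini exchanges the
  -- integrals.
  refine ae_eq_of_forall_setIntegral_eq_of_sigmaFinite ?_ ?_ ?_
  · intro S hS hS1
    exact (L2.integrable_inner (𝕜 := ℂ) (indicatorConstLp 2 hS hS1.ne (1 : ℂ))
      (ContinuousLinearMap.adjoint (primOp hε) g)).integrableOn (s := S) |>.congr_fun_ae (by
      filter_upwards [ae_restrict_mem hS, ae_restrict_of_ae
        (indicatorConstLp_coeFn (p := 2) (hs := hS) (hμs := hS1.ne) (c := (1 : ℂ)))] with y h1 h2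
      rw [h2, indicator_of_mem h1]
      simp)
  · intro S hS hS1
    have h1 := (integrable_prod_step hε g hS hS1).integral_prod_right
    simp_rw [hsw S] at h1
    rw [integrable_indicator_iff (hS.inter measurableSet_Ioi)] at h1
    exact h1.congr_set_ae (hpos S).symm
  · intro S hS hS1
    have h1 := integrable_prod_step hε g hS hS1
    have h2 := integral_integral_swap (f := fun x y => ({q : ℝ × ℝ | q.2 ∈ S ∧ 0 < q.2 ∧
      q.2 < q.1 ∧ q.1 < 1}.indicator fun q => g q.1) (x, y)) h1
    simp_rw [hsw S] at h2
    rw [integral_indicator (hS.inter measurableSet_Ioi), setIntegral_congr_set (hpos S)] at h2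
    rw [← h2, ← L2.inner_indicatorConstLp_one (𝕜 := ℂ) hS hS1.ne,
      ContinuousLinearMap.adjoint_inner_right, L2.inner_def]
    refine integral_congr_ae ?_
    filter_upwards [coeFn_primOp hε (indicatorConstLp 2 hS hS1.ne (1 : ℂ)), hae] with x h3 hx
    rw [h3]
    have h4 : ∫ y in Ioo 0 x, (indicatorConstLp 2 hS hS1.ne (1 : ℂ)) y ∂(pMeasure ε)
        = ((pMeasure ε).real (S ∩ Ioo 0 x) : ℂ) := by
      rw [setIntegral_congr_ae (g := S.indicator fun _ => (1 : ℂ)) measurableSet_Ioo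
        (indicatorConstLp_coeFn.mono fun y hy _ => hy), integral_indicator_const _ hS,
        measureReal_restrict_apply hS]
      simp
    have h5 : ∫ y, ({q : ℝ × ℝ | q.2 ∈ S ∧ 0 < q.2 ∧ q.2 < q.1 ∧ q.1 < 1}.indicator
        fun q => g q.1) (x, y) ∂(pMeasure ε) = (pMeasure ε).real (S ∩ Ioo 0 x) • g x := by
      rw [← integral_indicator_const _ (hS.inter measurableSet_Ioo)]
      refine integral_congr_ae (Eventually.of_forall fun y => ?_)
      classical
      simp only [indicator_apply, mem_ofPred_eq, mem_inter_iff, mem_Ioo, hx.2, and_true]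
    rw [h4, h5]
    simp [mul_comm]

/-! ### Smoothness of primitives and weighted averages -/

lemma hasDerivWithinAt_primitive {a b : ℝ} {g : ℝ → ℂ} (hg : ContinuousOn g (Icc a b)) {x : ℝ}
    (hx : x ∈ Icc a b) : HasDerivWithinAt (fun x => ∫ t in a..x, g t) (g x) (Icc a b) x := by
  have : Fact (x ∈ Icc a b) := ⟨hx⟩
  refine intervalIntegral.integral_hasDerivWithinAt_right ?_ ?_ (hg x hx)
  · exact (hg.mono (by rw [uIcc_of_le hx.1]; exact Icc_subset_Icc_right hx.2)).intervalIntegrable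
  · exact hg.stronglyMeasurableAtFilter_nhdsWithin measurableSet_Icc x

/-- The primitive of a function of class `C^n` on a closed interval is of class `C^(n+1)`. -/
theorem contDiffOn_primitive {a b : ℝ} (hab : a < b) {g : ℝ → ℂ} {n : ℕ}
    (hg : ContDiffOn ℝ n g (Icc a b)) :
    ContDiffOn ℝ (n + 1) (fun x => ∫ t in a..x, g t) (Icc a b) := by
  have hd := fun x hx => hasDerivWithinAt_primitive hg.continuousOn (x := x) hx
  rw [contDiffOn_succ_iff_derivWithin (uniqueDiffOn_Icc hab)]
  refine ⟨fun x hx => (hd x hx).differentiableWithinAt, by simp, ?_⟩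
  exact hg.congr fun x hx => (hd x hx).derivWithin (uniqueDiffOn_Icc hab x hx)

/-- The weighted average `t ↦ ∫₀¹ ρ(θ) φ(θ t) dθ`. -/
noncomputable def average (ρ : ℝ → ℝ) (φ : ℝ → ℂ) (t : ℝ) : ℂ :=
  ∫ θ in (0 : ℝ)..1, ρ θ • φ (θ * t)

lemma mul_mem_Icc_of_unit {c t θ : ℝ} (ht : t ∈ Icc 0 c) (hθ : θ ∈ Icc (0 : ℝ) 1) :
    θ * t ∈ Icc 0 c :=
  ⟨mul_nonneg hθ.1 ht.1, (mul_le_of_le_one_left ht.1 hθ.2).trans ht.2⟩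

lemma average_congr {ρ : ℝ → ℝ} {φ ψ : ℝ → ℂ} {c t : ℝ} (h : EqOn φ ψ (Icc 0 c))
    (ht : t ∈ Icc 0 c) : average ρ φ t = average ρ ψ t := by
  refine intervalIntegral.integral_congr fun θ hθ => ?_
  rw [uIcc_of_le zero_le_one] at hθ
  rw [h (mul_mem_Icc_of_unit ht hθ)]

lemma continuousOn_average {ρ : ℝ → ℝ} (hρ : Continuous ρ) {φ : ℝ → ℂ} {c : ℝ} (hc : 0 ≤ c)
    (hφ : ContinuousOn φ (Icc 0 c)) : ContinuousOn (average ρ φ) (Icc 0 c) := by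
  let ψ : ℝ → ℂ := IccExtend hc ((Icc 0 c).domRestrict φ)
  have hψ : Continuous ψ := (continuousOn_iff_continuous_domRestrict.1 hφ).Icc_extend'
  have he : EqOn φ ψ (Icc 0 c) := fun x hx => (IccExtend_of_mem hc ((Icc 0 c).domRestrict φ) hx).symm
  have : Continuous (average ρ ψ) := by
    unfold average
    refine intervalIntegral.continuous_parametric_intervalIntegral_of_continuous' ?_ 0 1
    fun_prop
  exact this.continuousOn.congr fun t ht => average_congr he ht

lemma hasDerivWithinAt_average {ρ : ℝ → ℝ} (hρ : Continuous ρ) {φ ψ : ℝ → ℂ} {c : ℝ} (hc : 0 ≤ c)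
    (hψ : ContinuousOn ψ (Icc 0 c))
    (hφ : ∀ x ∈ Icc 0 c, HasDerivWithinAt φ (ψ x) (Icc 0 c) x) {t : ℝ} (ht : t ∈ Icc 0 c) :
    HasDerivWithinAt (average ρ φ) (average (fun θ => θ * ρ θ) ψ t) (Icc 0 c) t := by
  let ψ' : ℝ → ℂ := IccExtend hc ((Icc 0 c).domRestrict ψ)
  have hψ' : Continuous ψ' := (continuousOn_iff_continuous_domRestrict.1 hψ).Icc_extend'
  have he : EqOn ψ ψ' (Icc 0 c) := fun x hx => (IccExtend_of_mem hc ((Icc 0 c).domRestrict ψ) hx).symm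
  -- A primitive of the extended derivative agrees with `φ` on `[0,c]` and is differentiable on the
  -- whole line, so two-sided differentiation under the integral applies even at the endpoints.
  let φ' : ℝ → ℂ := fun x => φ 0 + ∫ s in (0 : ℝ)..x, ψ' s
  have hφ' : ∀ x, HasDerivAt φ' (ψ' x) x := fun x =>
    (intervalIntegral.integral_hasDerivAt_right (hψ'.intervalIntegrable _ _)
      hψ'.stronglyMeasurable.stronglyMeasurableAtFilter hψ'.continuousAt).const_add _
  have hφc : Continuous φ' := continuous_iff_continuousAt.2 fun x => (hφ' x).continuousAt
  have heφ : EqOn φ φ' (Icc 0 c) := by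
    intro x hx
    have : ∫ s in (0 : ℝ)..x, ψ' s = φ x - φ 0 := by
      refine intervalIntegral.integral_eq_sub_of_hasDerivAt_of_le hx.1 ?_ ?_
        (hψ'.intervalIntegrable _ _)
      · exact fun y hy => ((hφ y ⟨hy.1, hy.2.trans hx.2⟩).continuousWithinAt).mono
          (Icc_subset_Icc_right hx.2)
      · intro y hy
        have hy' : y ∈ Icc 0 c := ⟨hy.1.le, hy.2.le.trans hx.2⟩
        rw [← he hy']
        exact (hφ y hy').hasDerivAt (Icc_mem_nhds hy.1 (hy.2.trans_le hx.2))
    simp [φ', this]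
  obtain ⟨M, hM⟩ := isCompact_Icc.exists_bound_of_continuousOn hψ
  have hM' : ∀ x, ‖ψ' x‖ ≤ M := fun x => hM _ (projIcc 0 c hc x).2
  have key : HasDerivAt (average ρ φ') (average (fun θ => θ * ρ θ) ψ' t) t := by
    unfold average
    refine (intervalIntegral.hasDerivAt_integral_of_dominated_loc_of_deriv_le (s := univ)
      (F := fun t θ => ρ θ • φ' (θ * t)) (F' := fun t θ => (θ * ρ θ) • ψ' (θ * t))
      (bound := fun θ => |θ * ρ θ| * M) univ_mem ?_ ?_ ?_ ?_ ?_ ?_).2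
    · exact Eventually.of_forall fun x =>
        (by fun_prop : Continuous fun θ => ρ θ • φ' (θ * x)).aestronglyMeasurable
    · exact (by fun_prop : Continuous fun θ => ρ θ • φ' (θ * t)).intervalIntegrable _ _
    · exact (by fun_prop : Continuous fun θ => (θ * ρ θ) • ψ' (θ * t)).aestronglyMeasurable
    · refine Eventually.of_forall fun θ _ x _ => ?_
      rw [norm_smul, Real.norm_eq_abs]
      exact mul_le_mul_of_nonneg_left (hM' _) (abs_nonneg _)
    · exact (by fun_prop : Continuous fun θ => |θ * ρ θ| * M).intervalIntegrable _ _
    · refine Eventually.of_forall fun θ _ x _ => ?_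
      have h1 : HasDerivAt (fun x => φ' (θ * x)) (θ • ψ' (θ * x)) x :=
        (hφ' (θ * x)).scomp x (by simpa using (hasDerivAt_id x).const_mul θ)
      refine (h1.const_smul (ρ θ)).congr_deriv ?_
      rw [smul_smul, mul_comm]
  rw [average_congr he ht]
  exact key.hasDerivWithinAt.congr (fun x hx => average_congr heφ hx) (average_congr heφ ht)

/-- Weighted averages preserve the class `C^n` on a closed interval. -/
theorem contDiffOn_average {c : ℝ} (hc : 0 < c) (n : ℕ) : ∀ {ρ : ℝ → ℝ} (_ : Continuous ρ)
    {φ : ℝ → ℂ} (_ : ContDiffOn ℝ n φ (Icc 0 c)), ContDiffOn ℝ n (average ρ φ) (Icc 0 c) := by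
  induction n with
  | zero =>
    intro ρ hρ φ hφ
    simp only [Nat.cast_zero, contDiffOn_zero] at hφ ⊢
    exact continuousOn_average hρ hc.le hφ
  | succ n ih =>
    intro ρ hρ φ hφ
    have hu := uniqueDiffOn_Icc hc
    push_cast at hφ ⊢
    have h1 := (contDiffOn_succ_iff_derivWithin hu).1 hφ
    have hd := fun t ht => hasDerivWithinAt_average (t := t) hρ hc.le h1.2.2.continuousOn
      (fun x hx => (h1.1 x hx).hasDerivWithinAt) ht
    rw [contDiffOn_succ_iff_derivWithin hu]
    refine ⟨fun x hx => (hd x hx).differentiableWithinAt, by simp, ?_⟩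
    -- Differentiation replaces the weight `ρ θ` by `θ * ρ θ`, which is why the induction is uniform
    -- in `ρ`.
    exact (ih (continuous_id.mul hρ) h1.2.2).congr fun x hx => (hd x hx).derivWithin (hu x hx)

/-- This divides a primitive by `x` without a singularity: the quotient is an average, as smooth at
`0` as `g`. -/
lemma mul_average_one (g : ℝ → ℂ) (x : ℝ) :
    (x : ℂ) * average (fun _ => 1) g x = ∫ y in (0 : ℝ)..x, g y := by
  have := intervalIntegral.smul_integral_comp_mul_right (a := 0) (b := 1) g x
  simp only [zero_mul, one_mul] at this
  rw [← this, average, Complex.real_smul]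
  simp

/-- Substitution expressing the integral over `(y,1)` against `(1-s)^a` as a weighted average. -/
lemma integral_one_sub_rpow_smul {a : ℝ} (φ : ℝ → ℂ) {y : ℝ} (hy : y < 1) :
    ∫ s in y..1, (1 - s) ^ a • φ s
      = ((1 - y) ^ a * (1 - y)) • average (fun θ => θ ^ a) (fun t => φ (1 - t)) (1 - y) := by
  have h1 : 0 < 1 - y := by linarith
  have e1 : ∫ s in y..1, (1 - s) ^ a • φ s = ∫ t in (0 : ℝ)..(1 - y), t ^ a • φ (1 - t) := by
    have := intervalIntegral.integral_comp_sub_left (a := y) (b := 1)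
      (fun t => t ^ a • φ (1 - t)) 1
    simpa using this
  rw [e1, average]
  have e2 := intervalIntegral.smul_integral_comp_mul_right (a := 0) (b := 1)
    (fun t => t ^ a • φ (1 - t)) (1 - y)
  simp only [zero_mul, one_mul] at e2
  have e3 : ∫ θ in (0 : ℝ)..1, (θ * (1 - y)) ^ a • φ (1 - θ * (1 - y))
      = (1 - y) ^ a • ∫ θ in (0 : ℝ)..1, θ ^ a • φ (1 - θ * (1 - y)) := by
    rw [← intervalIntegral.integral_smul]
    refine intervalIntegral.integral_congr fun θ hθ => ?_
    rw [uIcc_of_le zero_le_one] at hθ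
    rw [Real.mul_rpow hθ.1 h1.le, mul_comm, smul_smul]
  rw [← e2, e3, smul_smul, mul_comm]

/-! ### The inverse operator as an iterated integral -/

/-- The function `y ↦ ∫ᵧ¹ F(s) w(s) ds`. -/
noncomputable def tailInt (ε : ℝ) (F : ℝ → ℂ) (y : ℝ) : ℂ := ∫ s in y..1, w ε s • F s

lemma setIntegral_wMeasure_eq_tailInt (ε : ℝ) (F : ℝ → ℂ) {y : ℝ} (hy : y ∈ Ico (0 : ℝ) 1) :
    ∫ x in Ioo y 1, F x ∂(wMeasure ε) = tailInt ε F y := by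
  rw [tailInt, intervalIntegral.integral_of_le hy.2.le, integral_Ioc_eq_integral_Ioo]
  exact setIntegral_densityMeasure (measurable_w ε) (fun x hx => (w_pos ε hx).le)
    measurableSet_Ioo (Ioo_subset_Ioo_left hy.1) F

lemma w_le {ε : ℝ} (hε : 0 < ε) {x : ℝ} (hx : x ∈ Ioo (0 : ℝ) 1) :
    w ε x ≤ x⁻¹ * (1 - x) ^ (1 / ε) := by
  have h1 : 0 < 1 - x := by linarith [hx.2]
  have hx0 := hx.1
  have ha : 0 < 1 / ε := by positivity
  exact mul_le_of_le_one_right (by positivity)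
    (Real.rpow_le_one_of_one_le_of_nonpos (by linarith) (by linarith))

lemma w_le_inv {ε : ℝ} (hε : 0 < ε) {x : ℝ} (hx : x ∈ Ioo (0 : ℝ) 1) : w ε x ≤ x⁻¹ := by
  have hx0 := hx.1
  refine (w_le hε hx).trans (mul_le_of_le_one_right (by positivity) ?_)
  exact Real.rpow_le_one (by linarith [hx.2]) (by linarith) (by positivity)

/-- The factor `x⁻¹` makes the total mass infinite, so finiteness, and with it the inclusion of `L²`
in `L¹`, holds only away from `0`. -/
lemma wMeasure_Ioo_lt_top {ε : ℝ} (hε : 0 < ε) {y : ℝ} (hy : y ∈ Ioo (0 : ℝ) 1) :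
    wMeasure ε (Ioo y 1) < ⊤ := by
  have h : IntegrableOn (fun _ => (1 : ℝ)) (Ioo y 1) (densityMeasure (w ε)) := by
    rw [integrableOn_densityMeasure_iff (measurable_w ε) (fun x hx => (w_pos ε hx).le)
      measurableSet_Ioo (Ioo_subset_Ioo_left hy.1.le)]
    refine Measure.integrableOn_of_bounded (M := y⁻¹) (by simp)
      ((measurable_w ε).smul_const _).aestronglyMeasurable ?_
    refine (ae_restrict_iff' measurableSet_Ioo).2 (Eventually.of_forall fun x hx => ?_)
    have hx' : x ∈ Ioo (0 : ℝ) 1 := ⟨hy.1.trans hx.1, hx.2⟩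
    rw [smul_eq_mul, mul_one, Real.norm_of_nonneg (w_pos ε hx').le]
    exact (w_le_inv hε hx').trans (inv_anti₀ hy.1 hx.1.le)
  have h2 : densityMeasure (w ε) (Ioo y 1) < ⊤ := by simpa using h
  exact h2

lemma intervalIntegrable_w_smul {ε : ℝ} (hε : 0 < ε) (g : H ε) {y : ℝ} (hy : y ∈ Ioo (0 : ℝ) 1) :
    IntervalIntegrable (fun s => w ε s • g s) volume y 1 := by
  rw [intervalIntegrable_iff_integrableOn_Ioo_of_le hy.2.le]
  refine (integrableOn_densityMeasure_iff (measurable_w ε) (fun x hx => (w_pos ε hx).le)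
      measurableSet_Ioo (Ioo_subset_Ioo_left hy.1.le)).1 ?_
  have : IsFiniteMeasure ((wMeasure ε).restrict (Ioo y 1)) :=
    isFiniteMeasure_restrict.2 (wMeasure_Ioo_lt_top hε hy).ne
  exact ((Lp.memLp g).restrict (Ioo y 1)).integrable (by norm_num)

lemma ae_volume_of_ae_wMeasure {ε : ℝ} {P : ℝ → Prop} (h : ∀ᵐ x ∂(wMeasure ε), P x) :
    ∀ᵐ x, x ∈ Ioo (0 : ℝ) 1 → P x :=
  (ae_densityMeasure_iff (measurable_w ε) fun _ hx => w_pos ε hx).1 h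

lemma ae_volume_of_ae_pMeasure {ε : ℝ} {P : ℝ → Prop} (h : ∀ᵐ x ∂(pMeasure ε), P x) :
    ∀ᵐ x, x ∈ Ioo (0 : ℝ) 1 → P x :=
  (ae_densityMeasure_iff (measurable_inv_p ε) fun _ hx => inv_pos.2 (p_pos ε hx)).1 h

lemma ae_smul_eq_of_ae_eq {ε : ℝ} {f g : ℝ → ℂ} (h : f =ᵐ[wMeasure ε] g) {y : ℝ}
    (hy : y ∈ Ioo (0 : ℝ) 1) : ∀ᵐ s, s ∈ uIoc y 1 → w ε s • f s = w ε s • g s := by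
  filter_upwards [ae_volume_of_ae_wMeasure h, Measure.ae_ne volume 1] with s hs h1 hsy
  rw [uIoc_of_le hy.2.le] at hsy
  rw [hs ⟨hy.1.trans hsy.1, lt_of_le_of_ne hsy.2 h1⟩]

lemma tailInt_congr_ae {ε : ℝ} {f g : ℝ → ℂ} (h : f =ᵐ[wMeasure ε] g) {y : ℝ}
    (hy : y ∈ Ioo (0 : ℝ) 1) : tailInt ε f y = tailInt ε g y :=
  intervalIntegral.integral_congr_ae (ae_smul_eq_of_ae_eq h hy)

/-- The compact self-adjoint inverse of the Sturm–Liouville operator. -/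
noncomputable def greenOp {ε : ℝ} (hε : 0 < ε) : H ε →L[ℂ] H ε :=
  primOp hε ∘L ContinuousLinearMap.adjoint (primOp hε)

lemma ae_adjoint_primOp_eq {ε : ℝ} (hε : 0 < ε) (g : H ε) :
    ∀ᵐ y, y ∈ Ioo (0 : ℝ) 1 →
      (ContinuousLinearMap.adjoint (primOp hε) g) y = tailInt ε g y := by
  filter_upwards [ae_volume_of_ae_pMeasure (coeFn_adjoint_primOp hε g)] with y h1 hy
  rw [h1 hy, setIntegral_wMeasure_eq_tailInt ε _ ⟨hy.1.le, hy.2⟩]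

lemma ae_smul_adjoint_eq {ε : ℝ} (hε : 0 < ε) (g : H ε) {x : ℝ} (hx : x ≤ 1) :
    ∀ᵐ y, y ∈ Ioo 0 x → (p ε y)⁻¹ • (ContinuousLinearMap.adjoint (primOp hε) g) y
      = (p ε y)⁻¹ • tailInt ε g y := by
  filter_upwards [ae_adjoint_primOp_eq hε g] with y h1 hy
  rw [h1 ⟨hy.1, hy.2.trans_le hx⟩]

/-- Unlike the almost everywhere formula for `greenOp`, this holds at every point, and so yields
pointwise bounds. -/
lemma inner_stepLp_adjoint {ε : ℝ} (hε : 0 < ε) (g : H ε) {x : ℝ} (hx : x ∈ Ioo (0 : ℝ) 1) :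
    inner ℂ (stepLp ε x) (ContinuousLinearMap.adjoint (primOp hε) g)
      = ∫ y in (0 : ℝ)..x, (p ε y)⁻¹ • tailInt ε g y := by
  rw [inner_stepLp, cut_of_lt hx.2, intervalIntegral.integral_of_le hx.1.le,
    integral_Ioc_eq_integral_Ioo, setIntegral_densityMeasure (measurable_inv_p ε)
    (inv_p_nonneg ε) measurableSet_Ioo (Ioo_subset_Ioo_right hx.2.le)]
  exact setIntegral_congr_ae measurableSet_Ioo (ae_smul_adjoint_eq hε g hx.2.le)

lemma coeFn_greenOp {ε : ℝ} (hε : 0 < ε) (g : H ε) :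
    ∀ᵐ x ∂(wMeasure ε), greenOp hε g x = ∫ y in (0 : ℝ)..x, (p ε y)⁻¹ • tailInt ε g y := by
  filter_upwards [coeFn_primOp hε (ContinuousLinearMap.adjoint (primOp hε) g),
    ae_wMeasure (P := fun x => x ∈ Ioo (0 : ℝ) 1) fun _ hx => hx] with x h1 h2
  rw [← inner_stepLp_adjoint hε g h2, inner_stepLp, cut_of_lt h2.2, ← h1]
  rfl

/-- Up to null sets the tail integral is the adjoint applied to `g`, which is in `L²(p⁻¹ dx)`; on
`(0,x)` this measure is finite, so it is integrable there. -/
lemma integrableOn_inv_p_smul_tailInt {ε : ℝ} (hε : 0 < ε) (g : H ε) {x : ℝ}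
    (hx : x ∈ Ioo (0 : ℝ) 1) : IntegrableOn (fun y => (p ε y)⁻¹ • tailInt ε g y) (Icc 0 x) := by
  rw [integrableOn_Icc_iff_integrableOn_Ioo]
  have : IsFiniteMeasure ((pMeasure ε).restrict (Ioo 0 x)) :=
    isFiniteMeasure_restrict.2 (pMeasure_Ioo_lt_top ε hx.2).ne
  have h1 : IntegrableOn (ContinuousLinearMap.adjoint (primOp hε) g) (Ioo 0 x) (pMeasure ε) :=
    ((Lp.memLp _).restrict (Ioo 0 x)).integrable (by norm_num)
  rw [integrableOn_densityMeasure_iff (measurable_inv_p ε) (inv_p_nonneg ε) measurableSet_Ioo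
    (Ioo_subset_Ioo_right hx.2.le)] at h1
  exact h1.congr_fun_ae ((ae_restrict_iff' measurableSet_Ioo).2 (ae_smul_adjoint_eq hε g hx.2.le))

/-! ### Growth of eigenfunctions at the endpoints -/

/-- An eigenfunction of the inverse operator has a continuous representative that satisfies the
integral equation everywhere. -/
theorem exists_continuousOn_rep {ε : ℝ} (hε : 0 < ε) {f : H ε} {l : ℂ} (hl : l ≠ 0)
    (hf : greenOp hε f = l⁻¹ • f) :
    ∃ F : ℝ → ℂ, ContinuousOn F (Ioo 0 1) ∧ f =ᵐ[wMeasure ε] F ∧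
      (∀ x ∈ Ioo (0 : ℝ) 1, F x = l * ∫ y in (0 : ℝ)..x, (p ε y)⁻¹ • tailInt ε F y) ∧
      ∃ C, ∀ x ∈ Ioo (0 : ℝ) 1, ‖F x‖ ≤ C * stepBound ε x := by
  let F : ℝ → ℂ := fun x => l * ∫ y in (0 : ℝ)..x, (p ε y)⁻¹ • tailInt ε f y
  have hfF : f =ᵐ[wMeasure ε] F := by
    have h1 : (greenOp hε f : ℝ → ℂ) =ᵐ[wMeasure ε] fun x => l⁻¹ * f x := by
      rw [hf]
      exact Lp.coeFn_smul _ _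
    filter_upwards [h1, coeFn_greenOp hε f] with x h2 h3
    simp only [F]
    rw [← h3, h2, mul_inv_cancel_left₀ hl]
  refine ⟨F, ?_, hfF, ?_, ?_⟩
  · intro x hx
    have hc : (x + 1) / 2 ∈ Ioo (0 : ℝ) 1 := ⟨by linarith [hx.1], by linarith [hx.2]⟩
    have h1 := intervalIntegral.continuousOn_primitive_interval (a := 0) (b := (x + 1) / 2)
      (f := fun y => (p ε y)⁻¹ • tailInt ε f y)
      (by rw [uIcc_of_le hc.1.le]; exact integrableOn_inv_p_smul_tailInt hε f hc)
    rw [uIcc_of_le hc.1.le] at h1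
    exact ((h1.continuousAt (Icc_mem_nhds hx.1 (by linarith [hx.2]))).const_mul
      l).continuousWithinAt
  -- Tail integrals depend only on the class, so `F` may replace `f` inside its own definition.
  · intro x hx
    simp only [F]
    congr 1
    refine intervalIntegral.integral_congr_ae ?_
    filter_upwards with y hy
    rw [uIoc_of_le hx.1.le] at hy
    rw [tailInt_congr_ae hfF ⟨hy.1, hy.2.trans_lt hx.2⟩]
  -- Cauchy–Schwarz, with `F x` written as `l` times the pairing of `stepLp ε x` with the adjoint
  -- applied to `f`.
  · refine ⟨‖l‖ * ‖ContinuousLinearMap.adjoint (primOp hε) f‖, fun x hx => ?_⟩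
    simp only [F]
    rw [← inner_stepLp_adjoint hε f hx, norm_mul, mul_assoc]
    gcongr
    rw [mul_comm]
    exact (norm_inner_le_norm _ _).trans
      (mul_le_mul_of_nonneg_right (norm_stepLp_le hε hx) (norm_nonneg _))

lemma le_sqrt_self {y : ℝ} (hy : y ∈ Icc (0 : ℝ) 1) : y ≤ √y :=
  Real.le_sqrt_of_sq_le (by nlinarith [hy.1, hy.2])

lemma integral_rpow_neg_half_le {y : ℝ} (hy : y ∈ Icc (0 : ℝ) 1) :
    ∫ s in y..1, s ^ (-(1 / 2) : ℝ) ≤ 2 * (1 - y) := by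
  rw [integral_rpow (Or.inl (by norm_num))]
  norm_num
  rw [← Real.sqrt_eq_rpow]
  linarith [le_sqrt_self hy]

lemma integral_one_sub_rpow_neg_half_le {x : ℝ} (hx : x ∈ Icc (0 : ℝ) 1) :
    ∫ y in (0 : ℝ)..x, (1 - y) ^ (-(1 / 2) : ℝ) ≤ 2 * x := by
  have := intervalIntegral.integral_comp_sub_left (a := 0) (b := x)
    (fun t : ℝ => t ^ (-(1 / 2) : ℝ)) 1
  rw [this, sub_zero]
  refine (integral_rpow_neg_half_le ⟨by linarith [hx.2], by linarith [hx.1]⟩).trans ?_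
  linarith

/-- The integrand of the tail is at most `C s^(-1/2) (1-s)^(1/ε-b)`. Its last exponent is
nonnegative, so that power is largest at `y`, and integrating `s^(-1/2)` gives `2 (1-y)`.
Multiplying by `p⁻¹` leaves `(1-y)^(-b)`, with no singularity at `0`. -/
lemma norm_inv_p_smul_tailInt_le {ε : ℝ} (hε : 0 < ε) {F : ℝ → ℂ} {C b : ℝ} (hb : b ≤ 1 / ε)
    (hF : ∀ s ∈ Ioo (0 : ℝ) 1, ‖F s‖ ≤ C * (√s * (1 - s) ^ (-b))) {y : ℝ}
    (hy : y ∈ Ioo (0 : ℝ) 1) :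
    ‖(p ε y)⁻¹ • tailInt ε F y‖ ≤ 2 * 2 ^ (1 / ε) * C * (1 - y) ^ (-b) := by
  have hy1 : 0 < 1 - y := by linarith [hy.2]
  have hC : 0 ≤ C := by
    have h1 := (norm_nonneg _).trans (hF y hy)
    have h2 : 0 < √y := Real.sqrt_pos.2 hy.1
    exact nonneg_of_mul_nonneg_left h1 (by positivity)
  have hint : IntervalIntegrable (fun s : ℝ => s ^ (-(1 / 2) : ℝ)) volume y 1 :=
    intervalIntegral.intervalIntegrable_rpow' (by norm_num)
  have h1 : ‖tailInt ε F y‖ ≤ C * (1 - y) ^ (1 / ε - b) * (2 * (1 - y)) := by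
    calc ‖tailInt ε F y‖
        ≤ ∫ s in y..1, C * (1 - y) ^ (1 / ε - b) * s ^ (-(1 / 2) : ℝ) := by
          refine intervalIntegral.norm_integral_le_of_norm_le hy.2.le ?_ (hint.const_mul _)
          filter_upwards [Measure.ae_ne volume 1] with s hs1 hs
          have hs' : s ∈ Ioo (0 : ℝ) 1 := ⟨hy.1.trans hs.1, lt_of_le_of_ne hs.2 hs1⟩
          have h1s : 0 < 1 - s := by linarith [hs'.2]
          have h0s := hs'.1
          have e1 : s⁻¹ * √s = s ^ (-(1 / 2) : ℝ) := by
            rw [Real.sqrt_eq_rpow, ← Real.rpow_neg_one, ← Real.rpow_add hs'.1]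
            norm_num
          have e2 : (1 - s) ^ (1 / ε) * (1 - s) ^ (-b) = (1 - s) ^ (1 / ε - b) := by
            rw [← Real.rpow_add h1s, ← sub_eq_add_neg]
          rw [norm_smul, Real.norm_of_nonneg (w_pos ε hs').le]
          calc w ε s * ‖F s‖
              ≤ (s⁻¹ * (1 - s) ^ (1 / ε)) * (C * (√s * (1 - s) ^ (-b))) := by
                refine mul_le_mul (w_le hε hs') (hF s hs') (norm_nonneg _) (by positivity)
            _ = C * (1 - s) ^ (1 / ε - b) * s ^ (-(1 / 2) : ℝ) := by
                rw [← e1, ← e2]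
                ring
            _ ≤ C * (1 - y) ^ (1 / ε - b) * s ^ (-(1 / 2) : ℝ) := by
                have : (1 - s) ^ (1 / ε - b) ≤ (1 - y) ^ (1 / ε - b) :=
                  Real.rpow_le_rpow h1s.le (by linarith [hs.1]) (by linarith)
                gcongr
      _ ≤ C * (1 - y) ^ (1 / ε - b) * (2 * (1 - y)) := by
          rw [intervalIntegral.integral_const_mul]
          have := integral_rpow_neg_half_le ⟨hy.1.le, hy.2.le⟩
          gcongr
  rw [norm_smul, Real.norm_of_nonneg (inv_p_nonneg ε y hy)]
  calc (p ε y)⁻¹ * ‖tailInt ε F y‖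
      ≤ (2 ^ (1 / ε) * (1 - y) ^ (-(1 / ε) - 1)) * (C * (1 - y) ^ (1 / ε - b) * (2 * (1 - y))) :=
        mul_le_mul (inv_p_le hε ⟨hy.1.le, hy.2⟩) h1 (norm_nonneg _) (by positivity)
    _ = 2 * 2 ^ (1 / ε) * C * ((1 - y) ^ (-(1 / ε) - 1) * (1 - y) ^ (1 / ε - b) * (1 - y)) := by
        ring
    _ = 2 * 2 ^ (1 / ε) * C * (1 - y) ^ (-b) := by
        rw [← Real.rpow_add hy1, ← Real.rpow_add_one hy1.ne']
        congr 2
        ring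

/-- Split `(1-y)^(-b) ≤ (1-x)^(-c) (1-y)^(-1/2)`; the second factor integrates to at most `2 x`. One
integration thus gains half a power at `1` and a factor `x` at `0`. -/
lemma norm_integral_le_of_rpow_bound {k : ℝ → ℂ} {C b : ℝ}
    (hk : ∀ y ∈ Ioo (0 : ℝ) 1, ‖k y‖ ≤ C * (1 - y) ^ (-b)) {c : ℝ} (hc : 0 ≤ c)
    (hbc : b ≤ c + 1 / 2) {x : ℝ} (hx : x ∈ Ioo (0 : ℝ) 1) :
    ‖∫ y in (0 : ℝ)..x, k y‖ ≤ 2 * C * (x * (1 - x) ^ (-c)) := by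
  have hx1 : 0 < 1 - x := by linarith [hx.2]
  have hC : 0 ≤ C :=
    nonneg_of_mul_nonneg_left ((norm_nonneg _).trans (hk x hx)) (by positivity)
  have hint : IntervalIntegrable (fun y : ℝ => (1 - y) ^ (-(1 / 2) : ℝ)) volume 0 x := by
    refine ContinuousOn.intervalIntegrable fun y hy => ?_
    rw [uIcc_of_le hx.1.le] at hy
    exact ((continuousAt_const.sub continuousAt_id).rpow_const
      (Or.inl (by linarith [hy.2, hx.2] : 1 - y ≠ 0))).continuousWithinAt
  calc ‖∫ y in (0 : ℝ)..x, k y‖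
      ≤ ∫ y in (0 : ℝ)..x, C * (1 - x) ^ (-c) * (1 - y) ^ (-(1 / 2) : ℝ) := by
        refine intervalIntegral.norm_integral_le_of_norm_le hx.1.le ?_ (hint.const_mul _)
        filter_upwards with y hy
        have hy1 : 0 < 1 - y := by linarith [hy.2]
        refine (hk y ⟨hy.1, hy.2.trans_lt hx.2⟩).trans ?_
        rw [mul_assoc]
        gcongr
        calc (1 - y) ^ (-b) ≤ (1 - y) ^ (-c + -(1 / 2)) :=
              Real.rpow_le_rpow_of_exponent_ge hy1 (by linarith [hy.1]) (by linarith)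
          _ = (1 - y) ^ (-c) * (1 - y) ^ (-(1 / 2) : ℝ) := Real.rpow_add hy1 _ _
          _ ≤ (1 - x) ^ (-c) * (1 - y) ^ (-(1 / 2) : ℝ) := by
              have : (1 - y) ^ (-c) ≤ (1 - x) ^ (-c) :=
                Real.rpow_le_rpow_of_nonpos hx1 (by linarith [hy.2]) (by linarith)
              gcongr
    _ ≤ C * (1 - x) ^ (-c) * (2 * x) := by
        rw [intervalIntegral.integral_const_mul]
        have := integral_one_sub_rpow_neg_half_le ⟨hx.1.le, hx.2.le⟩
        gcongr
    _ = 2 * C * (x * (1 - x) ^ (-c)) := by ring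

/-- Each round lowers `b` by `1/2`; once `b ≤ 1/2`, the choice `c = 0` ends the iteration. The
inequality `x ≤ √x` returns the improved bound to the form of the hypothesis. -/
lemma exists_linear_bound_aux {ε : ℝ} (hε : 0 < ε) {F : ℝ → ℂ} {l : ℂ}
    (hF : ∀ x ∈ Ioo (0 : ℝ) 1, F x = l * ∫ y in (0 : ℝ)..x, (p ε y)⁻¹ • tailInt ε F y) (n : ℕ) :
    ∀ b C : ℝ, b ≤ 1 / ε → b ≤ (n + 1) / 2 →
      (∀ s ∈ Ioo (0 : ℝ) 1, ‖F s‖ ≤ C * (√s * (1 - s) ^ (-b))) →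
      ∃ C', ∀ x ∈ Ioo (0 : ℝ) 1, ‖F x‖ ≤ C' * x := by
  have step : ∀ b C c : ℝ, b ≤ 1 / ε → 0 ≤ c → b ≤ c + 1 / 2 →
      (∀ s ∈ Ioo (0 : ℝ) 1, ‖F s‖ ≤ C * (√s * (1 - s) ^ (-b))) →
      ∃ C', 0 ≤ C' ∧ ∀ x ∈ Ioo (0 : ℝ) 1, ‖F x‖ ≤ C' * (x * (1 - x) ^ (-c)) := by
    intro b C c hb hc hbc h
    refine ⟨‖l‖ * (2 * |2 * 2 ^ (1 / ε) * C|), by positivity, fun x hx => ?_⟩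
    rw [hF x hx, norm_mul, mul_assoc]
    refine mul_le_mul_of_nonneg_left (norm_integral_le_of_rpow_bound (fun y hy => ?_) hc hbc hx)
      (norm_nonneg _)
    have : 0 < 1 - y := by linarith [hy.2]
    exact (norm_inv_p_smul_tailInt_le hε hb h hy).trans
      (mul_le_mul_of_nonneg_right (le_abs_self _) (by positivity))
  induction n with
  | zero =>
    intro b C hb hn h
    obtain ⟨C', -, h'⟩ := step b C 0 hb le_rfl (by simpa using hn) h
    exact ⟨C', fun x hx => by simpa using h' x hx⟩
  | succ n ih =>
    intro b C hb hn h
    push_cast at hn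
    rcases le_total b (1 / 2) with hb2 | hb2
    · obtain ⟨C', -, h'⟩ := step b C 0 hb le_rfl (by simpa using hb2) h
      exact ⟨C', fun x hx => by simpa using h' x hx⟩
    · obtain ⟨C', hC', h'⟩ := step b C (b - 1 / 2) hb (by linarith) (by linarith) h
      refine ih (b - 1 / 2) C' (by linarith) (by linarith) fun x hx => (h' x hx).trans ?_
      have : 0 < 1 - x := by linarith [hx.2]
      have := le_sqrt_self ⟨hx.1.le, hx.2.le⟩
      gcongr

/-- A solution of the integral equation with the a priori growth of a square integrable
eigenfunction vanishes linearly at `0` and is bounded. -/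
theorem exists_linear_bound {ε : ℝ} (hε : 0 < ε) {F : ℝ → ℂ} {l : ℂ}
    (hF : ∀ x ∈ Ioo (0 : ℝ) 1, F x = l * ∫ y in (0 : ℝ)..x, (p ε y)⁻¹ • tailInt ε F y) {C : ℝ}
    (hC : ∀ x ∈ Ioo (0 : ℝ) 1, ‖F x‖ ≤ C * stepBound ε x) :
    ∃ C', ∀ x ∈ Ioo (0 : ℝ) 1, ‖F x‖ ≤ C' * x := by
  have ha : 0 < 1 / ε := by positivity
  obtain ⟨n, hn⟩ := exists_nat_ge (1 / ε)
  -- The square root in `stepBound` halves the exponent, so the iteration starts at `b = 1 / ε / 2`.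
  refine exists_linear_bound_aux hε hF n (1 / ε / 2) (C * √(primConst ε)) (by linarith)
    (by linarith) fun x hx => (hC x hx).trans (le_of_eq ?_)
  have h1 : 0 < 1 - x := by linarith [hx.2]
  rw [stepBound, Real.sqrt_mul (primConst_nonneg hε), Real.sqrt_mul hx.1.le,
    Real.sqrt_eq_rpow ((1 - x) ^ _), ← Real.rpow_mul h1.le, mul_assoc]
  congr 4
  ring

/-! ### Smoothness of eigenfunctions up to the endpoints -/

lemma contDiffOn_one_sub_rpow (a : ℝ) (n : ℕ) :
    ContDiffOn ℝ n (fun x : ℝ => (1 - x) ^ a) (Iio 1) :=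
  ContDiffOn.rpow_const_of_ne (by fun_prop) fun x (hx : x < 1) => by linarith

lemma contDiffOn_add_one_rpow (a : ℝ) (n : ℕ) :
    ContDiffOn ℝ n (fun x : ℝ => (x + 1) ^ a) (Ioi (-1)) :=
  ContDiffOn.rpow_const_of_ne (by fun_prop) fun x (hx : -1 < x) => by linarith

lemma contDiffOn_inv_p (ε : ℝ) (n : ℕ) :
    ContDiffOn ℝ n (fun x : ℝ => (p ε x)⁻¹) (Ico 0 1) := by
  refine ContDiffOn.inv (ContDiffOn.mul ?_ ?_) fun x hx => ?_
  · exact (contDiffOn_one_sub_rpow _ n).mono fun x hx => hx.2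
  · exact (contDiffOn_add_one_rpow _ n).mono fun x hx => lt_of_lt_of_le (by norm_num) hx.1
  · have h1 : 0 < 1 - x := by linarith [hx.2]
    have h2 : 0 < x + 1 := by linarith [hx.1]
    exact (mul_pos (Real.rpow_pos_of_pos h1 _) (Real.rpow_pos_of_pos h2 _)).ne'

/-- A continuous solution of the integral equation `F = l ∫₀ˣ p⁻¹ ∫ᵧ¹ w F` that vanishes at least
linearly at `0`. -/
structure IsLinearSolution (ε : ℝ) (l : ℂ) (F : ℝ → ℂ) : Prop where
  continuousOn : ContinuousOn F (Ioo 0 1)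
  eq_integral : ∀ x ∈ Ioo (0 : ℝ) 1, F x = l * ∫ y in (0 : ℝ)..x, (p ε y)⁻¹ • tailInt ε F y
  exists_bound : ∃ C, ∀ x ∈ Ioo (0 : ℝ) 1, ‖F x‖ ≤ C * x

/-- The derivative of a solution of the integral equation. -/
noncomputable def slopeFn (ε : ℝ) (l : ℂ) (F : ℝ → ℂ) (y : ℝ) : ℂ :=
  l * ((p ε y)⁻¹ • tailInt ε F y)

/-- The extension to `[0,1]` of a solution of the integral equation. -/
noncomputable def extFn (ε : ℝ) (l : ℂ) (F : ℝ → ℂ) (x : ℝ) : ℂ :=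
  ∫ y in (0 : ℝ)..x, slopeFn ε l F y

namespace IsLinearSolution

variable {ε : ℝ} {l : ℂ} {F : ℝ → ℂ}

lemma continuousOn_w : ContinuousOn (w ε) (Ioo 0 1) := by
  intro x hx
  have h1 : 1 - x ≠ 0 := by linarith [hx.2]
  have h2 : x + 1 ≠ 0 := by linarith [hx.1]
  unfold w
  exact (((continuousAt_id.inv₀ hx.1.ne').mul
    ((continuousAt_const.sub continuousAt_id).rpow_const (Or.inl h1))).mul
    ((continuousAt_id.add continuousAt_const).rpow_const (Or.inl h2))).continuousWithinAt

lemma integrableOn_w_smul (hε : 0 < ε) (hF : IsLinearSolution ε l F) :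
    IntegrableOn (fun s => w ε s • F s) (Icc 0 1) := by
  rw [integrableOn_Icc_iff_integrableOn_Ioo]
  obtain ⟨C, hC⟩ := hF.exists_bound
  refine Integrable.mono' (g := fun _ => C) (integrableOn_const (by simp))
    ((continuousOn_w.smul hF.continuousOn).aestronglyMeasurable measurableSet_Ioo) ?_
  refine (ae_restrict_iff' measurableSet_Ioo).2 (Eventually.of_forall fun s hs => ?_)
  rw [norm_smul, Real.norm_of_nonneg (w_pos ε hs).le]
  have hs0 := hs.1
  calc w ε s * ‖F s‖ ≤ s⁻¹ * (C * s) :=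
        mul_le_mul (w_le_inv hε hs) (hC s hs) (norm_nonneg _) (by positivity)
    _ = C := by field_simp

lemma continuousOn_tailInt (hε : 0 < ε) (hF : IsLinearSolution ε l F) :
    ContinuousOn (tailInt ε F) (Icc 0 1) := by
  have := intervalIntegral.continuousOn_primitive_interval_left (a := 0) (b := 1)
    (f := fun s => w ε s • F s) (μ := volume)
    (by rw [uIcc_of_le zero_le_one]; exact hF.integrableOn_w_smul hε)
  rwa [uIcc_of_le zero_le_one] at this

lemma hasDerivAt_tailInt (hε : 0 < ε) (hF : IsLinearSolution ε l F) {y : ℝ}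
    (hy : y ∈ Ioo (0 : ℝ) 1) : HasDerivAt (tailInt ε F) (-(w ε y • F y)) y := by
  have hc : ContinuousOn (fun s => w ε s • F s) (Ioo 0 1) := continuousOn_w.smul hF.continuousOn
  refine intervalIntegral.integral_hasDerivAt_left ?_ ?_
    (hc.continuousAt (Ioo_mem_nhds hy.1 hy.2))
  · rw [intervalIntegrable_iff_integrableOn_Icc_of_le hy.2.le]
    exact (hF.integrableOn_w_smul hε).mono_set (Icc_subset_Icc_left hy.1.le)
  · exact hc.stronglyMeasurableAtFilter isOpen_Ioo y hy

lemma continuousOn_slopeFn (hε : 0 < ε) (hF : IsLinearSolution ε l F) :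
    ContinuousOn (slopeFn ε l F) (Ico 0 1) :=
  continuousOn_const.mul ((contDiffOn_inv_p ε 0).continuousOn.smul
    ((hF.continuousOn_tailInt hε).mono Ico_subset_Icc_self))

lemma integrableOn_slopeFn (hε : 0 < ε) (hF : IsLinearSolution ε l F) :
    IntegrableOn (slopeFn ε l F) (Icc 0 1) := by
  rw [integrableOn_Icc_iff_integrableOn_Ioo]
  obtain ⟨C, hC⟩ := hF.exists_bound
  -- The linear bound is used in the form `b = 0`, which makes the slope bounded.
  have hC' : ∀ s ∈ Ioo (0 : ℝ) 1, ‖F s‖ ≤ |C| * (√s * (1 - s) ^ (-0 : ℝ)) := by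
    intro s hs
    rw [neg_zero, Real.rpow_zero, mul_one]
    exact (hC s hs).trans (mul_le_mul (le_abs_self _) (le_sqrt_self ⟨hs.1.le, hs.2.le⟩) hs.1.le
      (abs_nonneg _))
  refine Integrable.mono' (g := fun _ => ‖l‖ * (2 * 2 ^ (1 / ε) * |C|))
    (integrableOn_const (by simp)) (((hF.continuousOn_slopeFn hε).mono
      Ioo_subset_Ico_self).aestronglyMeasurable measurableSet_Ioo) ?_
  refine (ae_restrict_iff' measurableSet_Ioo).2 (Eventually.of_forall fun s hs => ?_)
  rw [slopeFn, norm_mul]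
  have := norm_inv_p_smul_tailInt_le hε (by positivity) hC' hs
  rw [neg_zero, Real.rpow_zero, mul_one] at this
  gcongr

lemma intervalIntegrable_slopeFn (hε : 0 < ε) (hF : IsLinearSolution ε l F) {a b : ℝ} (ha : 0 ≤ a)
    (hab : a ≤ b) (hb : b ≤ 1) : IntervalIntegrable (slopeFn ε l F) volume a b :=
  (intervalIntegrable_iff_integrableOn_Icc_of_le hab).2
    ((hF.integrableOn_slopeFn hε).mono_set (Icc_subset_Icc ha hb))

lemma extFn_eq (hF : IsLinearSolution ε l F) : EqOn (extFn ε l F) F (Ioo 0 1) := by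
  intro x hx
  rw [hF.eq_integral x hx, ← intervalIntegral.integral_const_mul]
  rfl

lemma continuousOn_extFn (hε : 0 < ε) (hF : IsLinearSolution ε l F) :
    ContinuousOn (extFn ε l F) (Icc 0 1) := by
  have := intervalIntegral.continuousOn_primitive_interval (a := 0) (b := 1)
    (f := slopeFn ε l F) (μ := volume)
    (by rw [uIcc_of_le zero_le_one]; exact hF.integrableOn_slopeFn hε)
  rwa [uIcc_of_le zero_le_one] at this

lemma hasDerivAt_extFn (hε : 0 < ε) (hF : IsLinearSolution ε l F) {x : ℝ}
    (hx : x ∈ Ioo (0 : ℝ) 1) : HasDerivAt (extFn ε l F) (slopeFn ε l F x) x := by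
  have hc := (hF.continuousOn_slopeFn hε).mono Ioo_subset_Ico_self
  exact intervalIntegral.integral_hasDerivAt_right
    (hF.intervalIntegrable_slopeFn hε le_rfl hx.1.le hx.2.le)
    (hc.stronglyMeasurableAtFilter isOpen_Ioo x hx) (hc.continuousAt (Ioo_mem_nhds hx.1 hx.2))

/-- Regularity at the end point `0`. -/
lemma contDiffOn_slopeFn (hε : 0 < ε) (hF : IsLinearSolution ε l F) {c : ℝ} (hc : c ∈ Ioo 0 1)
    (n : ℕ) : ContDiffOn ℝ n (slopeFn ε l F) (Icc 0 c) := by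
  have hsub : Icc 0 c ⊆ Ico 0 1 := Icc_subset_Ico_right hc.2
  induction n with
  | zero =>
    simp only [Nat.cast_zero, contDiffOn_zero]
    exact (hF.continuousOn_slopeFn hε).mono hsub
  | succ n ih =>
    -- Here `h s = F s / s`, so `w F = v h` with `v` smooth at `0`: the pole of `w` is absorbed, and
    -- the tail integral is a constant minus a primitive of a `C^n` function.
    let h := average (fun _ => 1) (slopeFn ε l F)
    have hh : ContDiffOn ℝ n h (Icc 0 c) := contDiffOn_average hc.1 n continuous_const ih
    let v : ℝ → ℝ := fun s => (1 - s) ^ (1 / ε) * (s + 1) ^ (-(1 / ε))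
    have hv : ContDiffOn ℝ n v (Icc 0 c) :=
      ((contDiffOn_one_sub_rpow _ n).mono fun x hx => (hsub hx).2).mul
        ((contDiffOn_add_one_rpow _ n).mono fun x hx => lt_of_lt_of_le (by norm_num) hx.1)
    have htail : EqOn (tailInt ε F) (fun y => tailInt ε F 0 - ∫ s in (0 : ℝ)..y, v s • h s)
        (Icc 0 c) := by
      intro y hy
      have h1 : ∫ s in (0 : ℝ)..y, v s • h s = ∫ s in (0 : ℝ)..y, w ε s • F s := by
        refine intervalIntegral.integral_congr_ae (Eventually.of_forall fun s hs => ?_)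
        rw [uIoc_of_le hy.1] at hs
        have hs' : s ∈ Ioo (0 : ℝ) 1 := ⟨hs.1, (hs.2.trans hy.2).trans_lt hc.2⟩
        have hs0 : (s : ℂ) ≠ 0 := by exact_mod_cast hs'.1.ne'
        rw [← hF.extFn_eq hs', extFn, ← mul_average_one]
        simp only [v, w, Complex.real_smul, h]
        push_cast
        field_simp
      have hi := hF.integrableOn_w_smul hε
      have h2 := intervalIntegral.integral_add_adjacent_intervals (μ := volume)
        (f := fun s => w ε s • F s) (a := 0) (b := y) (c := 1)
        ((intervalIntegrable_iff_integrableOn_Icc_of_le hy.1).2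
          (hi.mono_set (Icc_subset_Icc_right (hsub hy).2.le)))
        ((intervalIntegrable_iff_integrableOn_Icc_of_le (hsub hy).2.le).2
          (hi.mono_set (Icc_subset_Icc_left hy.1)))
      simp only
      rw [h1, tailInt, tailInt, ← h2, add_sub_cancel_left]
    have ht : ContDiffOn ℝ (n + 1 : ℕ) (tailInt ε F) (Icc 0 c) := by
      refine ContDiffOn.congr (contDiffOn_const.sub ?_) htail
      exact_mod_cast contDiffOn_primitive hc.1 (hv.smul hh)
    exact contDiffOn_const.mul (((contDiffOn_inv_p ε (n + 1)).mono hsub).smul ht)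

/-- Regularity at the end point `1`. -/
lemma contDiffOn_extFn_right (hε : 0 < ε) (hF : IsLinearSolution ε l F) {d : ℝ} (hd : d ∈ Ioo 0 1)
    (n : ℕ) : ContDiffOn ℝ n (extFn ε l F) (Icc d 1) := by
  have ha : 0 < 1 / ε := by positivity
  induction n with
  | zero =>
    simp only [Nat.cast_zero, contDiffOn_zero]
    exact (hF.continuousOn_extFn hε).mono (Icc_subset_Icc_left hd.1.le)
  | succ n ih =>
    -- `h` is `w F` without its only non-smooth factor `(1-s)^(1/ε)`, which becomes the weight
    -- `θ^(1/ε)` of the average below.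
    let h : ℝ → ℂ := fun s => (s⁻¹ * (s + 1) ^ (-(1 / ε))) • extFn ε l F s
    have hh : ContDiffOn ℝ n h (Icc d 1) := by
      have h1 : ContDiffOn ℝ n (fun s : ℝ => s⁻¹) (Icc d 1) :=
        contDiffOn_id.inv fun x hx => (hd.1.trans_le hx.1).ne'
      exact (h1.mul ((contDiffOn_add_one_rpow _ n).mono fun x hx =>
        lt_of_lt_of_le (by linarith [hd.1]) hx.1)).smul ih
    have hmap1 : MapsTo (fun t : ℝ => 1 - t) (Icc 0 (1 - d)) (Icc d 1) :=
      fun t ht => ⟨by linarith [ht.2], by linarith [ht.1]⟩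
    have hmap2 : MapsTo (fun t : ℝ => 1 - t) (Icc d 1) (Icc 0 (1 - d)) :=
      fun t ht => ⟨by linarith [ht.2], by linarith [ht.1]⟩
    have hφ : ContDiffOn ℝ n (fun t => h (1 - t)) (Icc 0 (1 - d)) :=
      hh.comp (contDiff_const.sub contDiff_id).contDiffOn hmap1
    let A := average (fun θ => θ ^ (1 / ε)) fun t => h (1 - t)
    have hA : ContDiffOn ℝ n A (Icc 0 (1 - d)) :=
      contDiffOn_average (by linarith [hd.2]) n (Real.continuous_rpow_const ha.le) hφ
    let k : ℝ → ℂ := fun y => l * ((y + 1) ^ (1 / ε - 1) • A (1 - y))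
    have hk : ContDiffOn ℝ n k (Icc d 1) := by
      have hA' : ContDiffOn ℝ n (fun y => A (1 - y)) (Icc d 1) :=
        hA.comp (contDiff_const.sub contDiff_id).contDiffOn hmap2
      exact contDiffOn_const.mul (((contDiffOn_add_one_rpow _ n).mono fun x hx =>
        lt_of_lt_of_le (by linarith [hd.1]) hx.1).smul hA')
    -- The exponents `1/ε + 1` of the rescaled tail and `-1/ε - 1` of `p⁻¹` add to zero. The point
    -- `1` is excluded; it is negligible under the integral.
    have hsl : EqOn (slopeFn ε l F) k (Ico d 1) := by
      intro y hy
      have hy0 : 0 < y := hd.1.trans_le hy.1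
      have hy1 : 0 < 1 - y := by linarith [hy.2]
      have h1 : tailInt ε F y = ((1 - y) ^ (1 / ε) * (1 - y)) • A (1 - y) := by
        simp only [A]
        rw [← integral_one_sub_rpow_smul h hy.2, tailInt]
        refine intervalIntegral.integral_congr_ae ?_
        filter_upwards [Measure.ae_ne volume 1] with s hs1 hs
        rw [uIoc_of_le hy.2.le] at hs
        have hs' : s ∈ Ioo (0 : ℝ) 1 := ⟨hy0.trans hs.1, lt_of_le_of_ne hs.2 hs1⟩
        simp only [h, w]
        rw [hF.extFn_eq hs', smul_smul]
        congr 1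
        ring
      simp only [slopeFn, k]
      rw [h1, inv_p_eq ε ⟨by linarith, hy.2⟩, smul_smul]
      congr 2
      rw [← Real.rpow_add_one hy1.ne', mul_right_comm, ← Real.rpow_add hy1, add_comm y 1,
        show -(1 / ε) - 1 + (1 / ε + 1) = 0 by ring, Real.rpow_zero, one_mul]
    have heq : EqOn (extFn ε l F) (fun x => extFn ε l F d + ∫ y in d..x, k y) (Icc d 1) := by
      intro x hx
      simp only [extFn]
      rw [← intervalIntegral.integral_add_adjacent_intervals
        (hF.intervalIntegrable_slopeFn hε le_rfl hd.1.le hd.2.le)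
        (hF.intervalIntegrable_slopeFn hε hd.1.le hx.1 hx.2)]
      congr 1
      refine intervalIntegral.integral_congr_ae ?_
      filter_upwards [Measure.ae_ne volume 1] with s hs1 hs
      rw [uIoc_of_le hx.1] at hs
      exact hsl ⟨hs.1.le, lt_of_le_of_ne (hs.2.trans hx.2) hs1⟩
    refine ContDiffOn.congr (contDiffOn_const.add ?_) heq
    exact_mod_cast contDiffOn_primitive hd.2 hk

theorem extFn_mem_smoothZero (hε : 0 < ε) (hF : IsLinearSolution ε l F) :
    extFn ε l F ∈ smoothZero := by
  refine ⟨contDiffOn_infty.2 fun n x hx => ?_, by simp [extFn]⟩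
  -- The intervals `[0, 3/4]` and `[1/4, 1]` overlap, so each point has one of them as a
  -- neighbourhood within `[0,1]`.
  rcases le_total x (1 / 2) with h | h
  · have h1 : ContDiffOn ℝ n (extFn ε l F) (Icc 0 (3 / 4)) := by
      have := contDiffOn_primitive (by norm_num)
        (hF.contDiffOn_slopeFn hε (c := 3 / 4) (by norm_num) n)
      exact this.of_le (by exact_mod_cast n.le_succ)
    refine (h1 x ⟨hx.1, by linarith⟩).mono_of_mem_nhdsWithin ?_
    filter_upwards [self_mem_nhdsWithin,
      mem_nhdsWithin_of_mem_nhds (Iio_mem_nhds (show x < 3 / 4 by linarith))] with y h2 h3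
    exact ⟨h2.1, le_of_lt h3⟩
  · have h1 := hF.contDiffOn_extFn_right hε (d := 1 / 4) (by norm_num) n
    refine (h1 x ⟨by linarith, hx.2⟩).mono_of_mem_nhdsWithin ?_
    filter_upwards [self_mem_nhdsWithin,
      mem_nhdsWithin_of_mem_nhds (Ioi_mem_nhds (show 1 / 4 < x by linarith))] with y h2 h3
    exact ⟨le_of_lt h3, h2.2⟩

/-- Here `p` times the derivative is `l` times the tail integral, whose derivative is `-w F`. -/
theorem expr_extFn (hε : 0 < ε) (hF : IsLinearSolution ε l F) {x : ℝ} (hx : x ∈ Ioo (0 : ℝ) 1) :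
    expr ε (extFn ε l F) x = l * extFn ε l F x := by
  have h1 : (fun y => (p ε y : ℂ) * deriv (extFn ε l F) y) =ᶠ[𝓝 x] fun y => l * tailInt ε F y := by
    filter_upwards [Ioo_mem_nhds hx.1 hx.2] with y hy
    have hp : (p ε y : ℂ) ≠ 0 := by exact_mod_cast (p_pos ε hy).ne'
    rw [(hF.hasDerivAt_extFn hε hy).deriv, slopeFn, Complex.real_smul]
    push_cast
    field_simp
  have hw : (w ε x : ℂ) ≠ 0 := by exact_mod_cast (w_pos ε hx).ne'
  rw [expr, h1.deriv_eq, ((hF.hasDerivAt_tailInt hε hx).const_mul l).deriv, hF.extFn_eq hx,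
    Complex.real_smul]
  field_simp

end IsLinearSolution

/-! ### Correspondence between the inverse operator and `L` -/

variable {ε : ℝ}

lemma isCompactOperator_primOp (hε : 0 < ε) : IsCompactOperator (primOp hε) :=
  isCompactOperator_carleman (aestronglyMeasurable_inner_stepLp ε) (memLp_stepBound hε)
    (ae_norm_stepLp_le hε)

lemma isCompactOperator_greenOp (hε : 0 < ε) : IsCompactOperator (greenOp hε) :=
  (isCompactOperator_primOp hε).comp_clm (ContinuousLinearMap.adjoint (primOp hε))

lemma inner_greenOp (hε : 0 < ε) (f g : H ε) :
    inner ℂ f (greenOp hε g) = inner ℂ (ContinuousLinearMap.adjoint (primOp hε) f)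
      (ContinuousLinearMap.adjoint (primOp hε) g) := by
  rw [ContinuousLinearMap.adjoint_inner_left, greenOp, ContinuousLinearMap.comp_apply]

lemma isSymmetric_greenOp (hε : 0 < ε) : (greenOp hε : H ε →ₗ[ℂ] H ε).IsSymmetric := by
  intro f g
  change inner ℂ (greenOp hε f) g = inner ℂ f (greenOp hε g)
  rw [inner_greenOp, ← inner_conj_symm, inner_greenOp, inner_conj_symm]

lemma re_inner_greenOp_nonneg (hε : 0 < ε) (f : H ε) : 0 ≤ (inner ℂ f (greenOp hε f)).re := by
  rw [inner_greenOp]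
  exact inner_self_nonneg (𝕜 := ℂ)

/-- Since `⟪f, T T* f⟫ = ‖T* f‖²`, the kernel consists of `f` whose tail integrals vanish; Lebesgue
differentiation then gives `w f = 0` almost everywhere. -/
lemma greenOp_injective (hε : 0 < ε) (f : H ε) (hf : greenOp hε f = 0) : f = 0 := by
  have h0 : ContinuousLinearMap.adjoint (primOp hε) f = 0 := by
    rw [← inner_self_eq_zero (𝕜 := ℂ), ← inner_greenOp, hf, inner_zero_right]
  have h1 : ∀ᵐ y, y ∈ Ioo (0 : ℝ) 1 → tailInt ε f y = 0 := by
    have hz : ∀ᵐ y ∂(pMeasure ε), (ContinuousLinearMap.adjoint (primOp hε) f) y = 0 := by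
      rw [h0]
      exact Lp.coeFn_zero _ _ _
    filter_upwards [ae_adjoint_primOp_eq hε f, ae_volume_of_ae_pMeasure hz] with y h2 h3 hy
    rw [← h2 hy, h3 hy]
  have hint : ∀ a ∈ Ioo (0 : ℝ) 1, IntegrableOn (fun s => w ε s • f s) (Icc a 1) := fun a ha =>
    (intervalIntegrable_iff_integrableOn_Icc_of_le ha.2.le).1 (intervalIntegrable_w_smul hε f ha)
  have hcont : ContinuousOn (tailInt ε f) (Ioo 0 1) := by
    intro y hy
    have ha : y / 2 ∈ Ioo (0 : ℝ) 1 := ⟨by linarith [hy.1], by linarith [hy.1, hy.2]⟩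
    have := intervalIntegral.continuousOn_primitive_interval_left (a := y / 2) (b := 1)
      (f := fun s => w ε s • f s) (μ := volume) (by rw [uIcc_of_le ha.2.le]; exact hint _ ha)
    rw [uIcc_of_le ha.2.le] at this
    exact (this.continuousAt (Icc_mem_nhds (by linarith [hy.1]) hy.2)).continuousWithinAt
  have h2 : EqOn (tailInt ε f) 0 (Ioo 0 1) :=
    Measure.eqOn_open_of_ae_eq ((ae_restrict_iff' measurableSet_Ioo).2 h1) isOpen_Ioo hcont
      continuousOn_const
  -- `w f` is known to be integrable only away from `0`, so the interval is exhausted from the left;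
  -- `n + 2` keeps the left end below `1` at `n = 0`.
  have h3 : ∀ n : ℕ, ∀ᵐ s, s ∈ Ioo (1 / ((n : ℝ) + 2)) 1 → w ε s • f s = 0 := by
    intro n
    have hn : 1 / ((n : ℝ) + 2) ∈ Ioo (0 : ℝ) 1 := by
      refine ⟨by positivity, ?_⟩
      rw [div_lt_one (by positivity)]
      linarith [n.cast_nonneg (α := ℝ)]
    filter_upwards [(intervalIntegrable_w_smul hε f hn).ae_hasDerivAt_integral] with s hs hs1
    rw [uIcc_of_le hn.2.le] at hs
    have h4 := hs ⟨hs1.1.le, hs1.2.le⟩ 1 ⟨hn.2.le, le_rfl⟩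
    have h5 : (fun x => ∫ t in (1 : ℝ)..x, w ε t • f t) =ᶠ[𝓝 s] fun _ => 0 := by
      filter_upwards [Ioo_mem_nhds (hn.1.trans hs1.1) hs1.2] with x hx
      rw [intervalIntegral.integral_symm]
      have := h2 hx
      rw [tailInt] at this
      rw [this]
      simp
    exact h4.unique ((hasDerivAt_const s (0 : ℂ)).congr_of_eventuallyEq h5)
  rw [Lp.eq_zero_iff_ae_eq_zero]
  refine (ae_densityMeasure_iff (measurable_w ε) fun _ hx => w_pos ε hx).2 ?_
  filter_upwards [ae_all_iff.2 h3] with s hs hs1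
  obtain ⟨n, hn⟩ := exists_nat_one_div_lt hs1.1
  have h4 : 1 / ((n : ℝ) + 2) < s := by
    refine lt_of_le_of_lt (one_div_le_one_div_of_le (by positivity) (by linarith)) hn
  exact (smul_eq_zero.1 (hs n ⟨h4, hs1.2⟩)).resolve_left (w_pos ε hs1).ne'

lemma coeFn_incl (hε : 0 < ε) (f : smoothZero) :
    (incl hε f : ℝ → ℂ) =ᵐ[wMeasure ε] (f : ℝ → ℂ) :=
  (smooth_memLp hε f.2).coeFn_toLp

lemma coeFn_exprMap (hε : 0 < ε) (f : smoothZero) :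
    (exprMap hε f : ℝ → ℂ) =ᵐ[wMeasure ε] expr ε f :=
  (expr_memLp hε f.2).coeFn_toLp

/-- Eigenvectors of the inverse operator are eigenvectors of the Sturm–Liouville operator. -/
theorem isEigenvector_L_of_greenOp (hε : 0 < ε) {f : H ε} (hf0 : f ≠ 0) {l : ℂ} (hl : l ≠ 0)
    (hf : greenOp hε f = l⁻¹ • f) : IsEigenvector (L hε) l f := by
  obtain ⟨F, hFc, hfF, hFi, C, hC⟩ := exists_continuousOn_rep hε hl hf
  have hF : IsLinearSolution ε l F := ⟨hFc, hFi, exists_linear_bound hε hFi hC⟩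
  let φ : smoothZero := ⟨extFn ε l F, hF.extFn_mem_smoothZero hε⟩
  have hφ : incl hε φ = f := by
    refine Lp.ext ((coeFn_incl hε φ).trans (EventuallyEq.trans ?_ hfF.symm))
    exact ae_wMeasure fun x hx => hF.extFn_eq hx
  have hLφ : exprMap hε φ = l • f := by
    refine Lp.ext ((coeFn_exprMap hε φ).trans (EventuallyEq.trans ?_ (Lp.coeFn_smul l f).symm))
    filter_upwards [hfF, ae_wMeasure (P := fun x => x ∈ Ioo (0 : ℝ) 1) fun _ hx => hx]
      with x h1 hx
    rw [Pi.smul_apply, h1, smul_eq_mul, ← hF.extFn_eq hx]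
    exact hF.expr_extFn hε hx
  refine ⟨hf0, hφ ▸ LinearMap.mem_range_self _ φ, ?_⟩
  rw [← hLφ, ← L_apply hε φ]
  congr 1
  exact Subtype.ext hφ.symm

lemma continuousOn_p_Icc (hε : 0 < ε) : ContinuousOn (p ε) (Icc 0 1) := by
  have ha : 0 < 1 / ε := by positivity
  intro x hx
  have h2 : x + 1 ≠ 0 := by linarith [hx.1]
  unfold p
  exact (((continuousAt_const.sub continuousAt_id).rpow_const (Or.inr (by linarith))).mul
    ((continuousAt_id.add continuousAt_const).rpow_const (Or.inl h2))).continuousWithinAt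

/-- The integrand is the derivative of `-p f'`, and the boundary term at `1` drops out because `p ε
1 = 0`. No boundary condition on `f` at `1` is needed. -/
lemma tailInt_expr (hε : 0 < ε) (f : smoothZero) {y : ℝ} (hy : y ∈ Ioo (0 : ℝ) 1) :
    tailInt ε (expr ε f) y = (p ε y : ℂ) * derivWithin (f : ℝ → ℂ) (Icc 0 1) y := by
  have ha : 0 < 1 / ε := by positivity
  have hsub : Ioo y 1 ⊆ Ioo 0 1 := Ioo_subset_Ioo_left hy.1.le
  have hd := contDiffOn_deriv f.2
  have hint : IntervalIntegrable (fun s => w ε s • expr ε f s) volume y 1 := by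
    refine (intervalIntegrable_w_smul hε (exprMap hε f) hy).congr_ae ?_
    exact (ae_restrict_iff' measurableSet_uIoc).2 (ae_smul_eq_of_ae_eq (coeFn_exprMap hε f) hy)
  have hcont : ContinuousOn (fun s => -((p ε s : ℂ) * derivWithin (f : ℝ → ℂ) (Icc 0 1) s))
      (Icc y 1) := by
    refine (ContinuousOn.mul ?_ hd.continuousOn).neg.mono (Icc_subset_Icc_left hy.1.le)
    exact Complex.continuous_ofReal.comp_continuousOn (continuousOn_p_Icc hε)
  have hder : ∀ s ∈ Ioo y 1, HasDerivAt
      (fun s => -((p ε s : ℂ) * derivWithin (f : ℝ → ℂ) (Icc 0 1) s)) (w ε s • expr ε f s) s := by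
    intro s hs
    have hs' := hsub hs
    have h1 : DifferentiableAt ℝ (fun s => (p ε s : ℂ) * derivWithin (f : ℝ → ℂ) (Icc 0 1) s) s :=
      ((hasDerivAt_p ε hs').ofReal_comp.differentiableAt).mul (differentiableAt_of_mem hd hs')
    have h2 : (fun y => (p ε y : ℂ) * deriv (f : ℝ → ℂ) y) =ᶠ[𝓝 s]
        fun s => (p ε s : ℂ) * derivWithin (f : ℝ → ℂ) (Icc 0 1) s := by
      filter_upwards [Ioo_mem_nhds hs'.1 hs'.2] with t ht
      rw [deriv_eqOn ht]
    refine h1.hasDerivAt.neg.congr_deriv ?_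
    have hw : (w ε s : ℂ) ≠ 0 := by exact_mod_cast (w_pos ε hs').ne'
    rw [expr, h2.deriv_eq, Complex.real_smul]
    field_simp
  rw [tailInt, intervalIntegral.integral_eq_sub_of_hasDerivAt_of_le hy.2.le hcont hder hint]
  have hp1 : p ε 1 = 0 := by
    unfold p
    rw [sub_self, Real.zero_rpow (by linarith), zero_mul]
  simp [hp1]

/-- The operator `greenOp` is a left inverse of the Sturm–Liouville operator. -/
theorem greenOp_exprMap (hε : 0 < ε) (f : smoothZero) :
    greenOp hε (exprMap hε f) = incl hε f := by
  refine Lp.ext ?_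
  filter_upwards [coeFn_greenOp hε (exprMap hε f), coeFn_incl hε f,
    ae_wMeasure (P := fun x => x ∈ Ioo (0 : ℝ) 1) fun _ hx => hx] with x h1 h2 hx
  rw [h1, h2]
  have hsub : Icc 0 x ⊆ Icc 0 1 := Icc_subset_Icc_right hx.2.le
  have hd := contDiffOn_deriv f.2
  have h3 : ∫ y in (0 : ℝ)..x, (p ε y)⁻¹ • tailInt ε (exprMap hε f) y
      = ∫ y in (0 : ℝ)..x, derivWithin (f : ℝ → ℂ) (Icc 0 1) y := by
    refine intervalIntegral.integral_congr_ae (Eventually.of_forall fun y hy => ?_)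
    rw [uIoc_of_le hx.1.le] at hy
    have hy' : y ∈ Ioo (0 : ℝ) 1 := ⟨hy.1, hy.2.trans_lt hx.2⟩
    have hp : (p ε y : ℂ) ≠ 0 := by exact_mod_cast (p_pos ε hy').ne'
    rw [tailInt_congr_ae (coeFn_exprMap hε f) hy', tailInt_expr hε f hy', Complex.real_smul]
    push_cast
    field_simp
  rw [h3, intervalIntegral.integral_eq_sub_of_hasDerivAt_of_le hx.1.le
    (f.2.1.continuousOn.mono hsub) (fun y hy => ?_)]
  -- The boundary condition at `0` removes the constant of integration.
  · rw [f.2.2, sub_zero]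
  · refine ContinuousOn.intervalIntegrable ?_
    rw [uIcc_of_le hx.1.le]
    exact hd.continuousOn.mono hsub
  · have hy' : y ∈ Ioo (0 : ℝ) 1 := ⟨hy.1, hy.2.trans hx.2⟩
    rw [← deriv_eqOn hy']
    exact (differentiableAt_of_mem f.2.1 hy').hasDerivAt

/-- Eigenvectors of the Sturm–Liouville operator are eigenvectors of the inverse operator. -/
theorem greenOp_smul_of_isEigenvector (hε : 0 < ε) {ν : ℂ} {u : H ε}
    (hu : IsEigenvector (L hε) ν u) : ν • greenOp hε u = u := by
  obtain ⟨-, ⟨f, rfl⟩, hL⟩ := hu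
  rw [L_apply] at hL
  rw [← map_smul, ← hL, greenOp_exprMap]

/-- The functions `x ↦ x q(x)`, `q` a polynomial, as elements of the domain. -/
noncomputable def polyMap : Polynomial ℂ →ₗ[ℂ] smoothZero where
  toFun q := ⟨fun x => (x : ℂ) * q.eval (x : ℂ), by
    refine ⟨ContDiff.contDiffOn ?_, by simp⟩
    have h1 : ContDiff ℝ ∞ fun x : ℝ => (x : ℂ) := Complex.ofRealCLM.contDiff
    have h2 : ContDiff ℝ ∞ fun z : ℂ => q.eval z :=
      (Polynomial.contDiff_aeval q ∞ : ContDiff ℂ ∞ _).restrict_scalars ℝ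
    exact h1.mul (h2.comp h1)⟩
  map_add' q r := by
    ext x
    simp [mul_add]
  map_smul' c q := by
    ext x
    simp [mul_left_comm]

/-- The functions `x q(x)` embed the polynomials: one that vanishes on `(0,1)` forces `q` to have
infinitely many roots. -/
theorem not_finiteDimensional_H (hε : 0 < ε) : ¬ FiniteDimensional ℂ (H ε) := by
  intro hfin
  have hinj : Function.Injective (incl hε ∘ₗ polyMap) := by
    rw [injective_iff_map_eq_zero]
    intro q hq
    have h0 : (polyMap q : ℝ → ℂ) =ᵐ[wMeasure ε] 0 :=
      (coeFn_incl hε (polyMap q)).symm.trans (Lp.eq_zero_iff_ae_eq_zero.1 hq)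
    have h1 := ae_eq_zero_imp ((polyMap q).2.1.continuousOn.mono Ioo_subset_Icc_self) h0
    refine Polynomial.eq_zero_of_infinite_isRoot q
      (((Ioo_infinite (zero_lt_one' ℝ)).image Complex.ofReal_injective.injOn).mono ?_)
    rintro _ ⟨x, hx, rfl⟩
    have h2 : (x : ℂ) * q.eval (x : ℂ) = 0 := h1 hx
    exact (mul_eq_zero.1 h2).resolve_left (by exact_mod_cast hx.1.ne')
  have := FiniteDimensional.of_injective _ hinj
  exact Polynomial.not_finite (R := ℂ) this

end SturmLiouville

/-! ### The eigenbasis of `L` and completeness of the list of eigenvalues -/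

theorem mainTheorem7 (ε : ℝ) (hε : 0 < ε) (hε2 : ε < 2) :
    ∃ (f : ℕ → SturmLiouville.H ε) (μ : ℕ → ℝ),
      Orthonormal ℂ f ∧
      (Submodule.span ℂ (Set.range f)).topologicalClosure = ⊤ ∧
      (∀ n, SturmLiouville.IsEigenvector (SturmLiouville.L hε) (μ n : ℂ) (f n)) ∧
      (∀ n, 0 ≤ μ n) ∧
      Monotone μ ∧
      Tendsto μ atTop atTop ∧
      (∀ (ν : ℂ) (u : SturmLiouville.H ε),
        SturmLiouville.IsEigenvector (SturmLiouville.L hε) ν u → ∃ n, ν = (μ n : ℂ)) := by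
  obtain ⟨f, μ, hf, hspan, hK, hpos, hmono, hlim⟩ :=
    SturmLiouville.exists_eigenbasis_of_isCompactOperator
      (SturmLiouville.isCompactOperator_greenOp hε) (SturmLiouville.isSymmetric_greenOp hε)
      (SturmLiouville.re_inner_greenOp_nonneg hε) (SturmLiouville.greenOp_injective hε)
      (SturmLiouville.not_finiteDimensional_H hε)
  refine ⟨f, μ, hf, hspan, fun n => ?_, fun n => (hpos n).le, hmono, hlim, fun ν u hu => ?_⟩
  · exact SturmLiouville.isEigenvector_L_of_greenOp hε (hf.ne_zero n)
      (by exact_mod_cast (hpos n).ne') (hK n)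
  · by_contra! hne
    refine hu.1 ?_
    have h1 := SturmLiouville.greenOp_smul_of_isEigenvector hε hu
    -- Symmetry gives `⟪f n, u⟫ = ν (μ n)⁻¹ ⟪f n, u⟫`, so a nonzero coefficient would force `ν = μ
    -- n`. Neither reality nor nonvanishing of `ν` is needed.
    have horth : ∀ n, inner ℂ (f n) u = 0 := by
      intro n
      have hs := SturmLiouville.isSymmetric_greenOp hε (f n) u
      change inner ℂ (SturmLiouville.greenOp hε (f n)) u
        = inner ℂ (f n) (SturmLiouville.greenOp hε u) at hs
      have h2 : inner ℂ (f n) u = ν * inner ℂ (f n) (SturmLiouville.greenOp hε u) := by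
        rw [← inner_smul_right, h1]
      rw [← hs, hK, inner_smul_left] at h2
      have hμ : (μ n : ℂ) ≠ 0 := by exact_mod_cast (hpos n).ne'
      simp only [map_inv₀, Complex.conj_ofReal] at h2
      by_contra h0
      refine hne n ?_
      field_simp at h2
      exact h2.symm
    have hmem : u ∈ (Submodule.span ℂ (range f))ᗮ := by
      rw [Submodule.mem_orthogonal]
      intro v hv
      induction hv using Submodule.span_induction with
      | mem x hx =>
        obtain ⟨n, rfl⟩ := hx
        exact horth n
      | zero => exact inner_zero_left _
      | add x y _ _ hx hy => rw [inner_add_left, hx, hy, add_zero]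
      | smul a x _ hx => rw [inner_smul_left, hx, mul_zero]
    rw [(Submodule.topologicalClosure_eq_top_iff).1 hspan] at hmem
    exact (Submodule.mem_bot ℂ).1 hmem
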